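/- Identify $\mathbb{R}^2$ with $\mathbb{C}$ via $z=x+iy$, let $\varphi(t)=e^{-\pi t^2}$, and for $f\in L^2(\mathbb{R})$ (complex-valued) let $$V_\varphi f(x,y)=\int_{\mathbb{R}} f(t)\,\overline{\varphi(t-x)}\,e^{-2\pi i t y}\,dt$$ be its Gabor transform. Write $B_r(z)$ for the open disc of radius $r$ and center $z$ (empty if $r=0$). For $D_0\subset D\subset\mathbb{C}$ put $D_+:=D\setminus\overline{D_0}$, and for $\Delta\ge\delta>0$ let $\mathcal{H}(D,D_0,\delta,\Delta)$ be the class of atoll functions on $D$ with lagoon $D_0$: the functions $F\in C^1(D)$ (in the real sense) such that $|F|\le\Delta$ on $D$, $|\nabla|F||\le\Delta$ at all points of $D$ where $|F|$ is differentiable, and $|F|\ge\delta$ on $D_+$. For $U\subset\mathbb{C}$ open, let $\|u\|_{W^{1,2}(U)}=\|u\|_{L^2(U)}+\|\nabla u\|_{L^2(U)}$, with $\nabla u$ the weak gradient. **Theorem.** There exist a continuous function $\rho:[0,1)\to(0,\infty)$ and a constant $c>0$, both universal, such that the following holds. Let $k\in\mathbb{N}$ and, for $j=1,\dots,k$, let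 $z_j\in\mathbb{C}$, $0\le r_j<s_j$, $\Delta_j\ge\delta_j>0$, $D_j:=B_{s_j}(z_j)$, $D_{0,j}:=B_{r_j}(z_j)$ and $(D_j)_+:=D_j\setminus\overline{D_{0,j}}$. Suppose that $f\in L^2(\mathbb{R})$ and $$(V_\varphi f)|_{D_j}\in\mathcal{H}(D_j,D_{0,j},\delta_j,\Delta_j)\qquad\text{for all } j=1,\dots,k.$$ Then for every $g\in L^2(\mathbb{R})$ the function $|V_\varphi f|-|V_\varphi g|$ belongs to $W^{1,2}\big(\bigcup_{j=1}^k (D_j)_+\big)$ and $$\inf_{\alpha_1,\dots,\alpha_k\in\mathbb{R}}\sum_{j=1}^k\big\|V_\varphi f-e^{i\alpha_j}V_\varphi g\big\|_{L^2(D_j)}\le c\left(\sum_{j=1}^k\frac{\Delta_j^2}{\delta_j^2}\Big(1+\rho\big(\tfrac{r_j}{s_j}\big)s_j\Big)\Big(1+r_j^{1/2}\rho\big(\tfrac{r_j}{s_j}\big)\big(s_j^{1/2}+s_j^{-1/2}\big)e^{\pi r_j^2/2}\Big)\right)\big\||V_\varphi f|-|V_\varphi g|\big\|_{W^{1,2}\left(\bigcup_{j=1}^k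 (D_j)_+\right)}.$$ -/

import Mathlib

open MeasureTheory Set
open scoped ENNReal ContDiff ComplexConjugate Gradient

noncomputable section

namespace GaborPhase

/-- The windowed Fourier transform `V_g f (x, y) = ∫ f(t) conj(g(t - x)) e^{-2πity} dt`, as a
function of `z = x + iy`; the time-frequency plane `ℝ²` is identified with `ℂ`. -/
def windowedFourier (g f : ℝ → ℂ) (z : ℂ) : ℂ :=
  ∫ t : ℝ, f t * conj (g (t - z.re)) *
    Complex.exp (-(2 * Real.pi * Complex.I * (t : ℂ) * (z.im : ℂ)))

/-- The Gaussian window `φ(t) = e^{-πt²}`. -/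
def gaussianWindow (t : ℝ) : ℂ := (Real.exp (-(Real.pi * t ^ 2)) : ℂ)

/-- The Gabor transform: the windowed Fourier transform with Gaussian window. -/
def gabor (f : ℝ → ℂ) : ℂ → ℂ := windowedFourier gaussianWindow f

/-- The atoll `D₊ = D \ closure D₀` of a set `D` with lagoon `D₀` (possibly empty). -/
def atoll (D D₀ : Set ℂ) : Set ℂ := D \ closure D₀

/-- The class `H(D, D₀, δ, Δ)` of atoll functions on `D` with lagoon `D₀`: `F` is `C¹` on `D` in the
real sense, `|F|` and the Euclidean length of `∇|F|` are at most `Δ` on `D`, and `|F| ≥ δ` on the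
atoll. As `|F|` need not be differentiable at a zero of `F`, the bound on the gradient is asked
for at the points of differentiability of `|F|`. -/
structure IsAtollFunction (F : ℂ → ℂ) (D D₀ : Set ℂ) (δ Δ : ℝ) : Prop where
  contDiffOn : ContDiffOn ℝ 1 F D
  norm_le : ∀ z ∈ D, ‖F z‖ ≤ Δ
  norm_gradient_le : ∀ z ∈ D, DifferentiableAt ℝ (fun w : ℂ => ‖F w‖) z →
    ‖gradient (fun w : ℂ => ‖F w‖) z‖ ≤ Δ
  le_norm : ∀ z ∈ atoll D D₀, δ ≤ ‖F z‖

/-- `G` is a weak gradient of the real function `u` on the open set `U`; the vector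
`(G₁, G₂) ∈ ℝ²` is written as the complex number `G₁ + i G₂`. -/
def IsWeakGradient (U : Set ℂ) (u : ℂ → ℝ) (G : ℂ → ℂ) : Prop :=
  LocallyIntegrableOn u U ∧ LocallyIntegrableOn G U ∧
    ∀ φ : ℂ → ℝ, ContDiff ℝ ∞ φ → HasCompactSupport φ → tsupport φ ⊆ U →
      ∫ z in U, u z • gradient φ z = -∫ z in U, φ z • G z

/-- Membership in the Sobolev space `W^{1,p}(U)`. -/
def MemSobolev (u : ℂ → ℝ) (p : ℝ≥0∞) (U : Set ℂ) : Prop :=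
  MemLp u p (volume.restrict U) ∧
    ∃ G : ℂ → ℂ, IsWeakGradient U u G ∧ MemLp G p (volume.restrict U)

/-- The norm `‖u‖_{L^p(U)} + ‖∇u‖_{L^p(U)}` of `W^{1,p}(U)`, with `∇u` the weak gradient. Since
weak gradients on `U` are unique almost everywhere, the infimum only selects the weak gradient;
the value is `∞` if there is none. -/
def sobolevNorm (u : ℂ → ℝ) (p : ℝ≥0∞) (U : Set ℂ) : ℝ≥0∞ :=
  ⨅ (G : ℂ → ℂ) (_ : IsWeakGradient U u G),
    eLpNorm u p (volume.restrict U) + eLpNorm G p (volume.restrict U)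

end GaborPhase

end

/-! Up to conjugation, `gabor f z` is `exp (-π x²)` times the entire function `entireTransform f`
(`conj_gabor`). On an atoll, where `f` has no zeros, the quotient `u` of the entire functions of `g`
and `f` is therefore holomorphic, and its modulus is `|V g| / |V f|`. With `v = |V f| - |V g|` this
reads `|u| = 1 - v / |V f|`. A holomorphic function satisfies `|u'| ≤ |∇|u||` wherever `|u|` is
differentiable, so `|u'|` is at most `Δ/δ² (|v| + |∇v|)` almost everywhere
(`norm_deriv_le_of_norm_eq`): phase variation is controlled by moduli alone.

A Poincaré inequality on the annulus (`exists_lintegral_sub_sq_le_lintegral_deriv`) then puts `u`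
close to a constant `m`. As `|u|` is close to 1, so is `|m|`, and `m` may be replaced by `exp (i arg
m)`; this is the phase (`exists_phase_eLpNorm_annulus_le`). The Poincaré constant does not
degenerate on thin annuli, because the mean of `u` over a circle does not depend on the radius.

The bound enters the lagoon because `V f - e^{iα} V g` is again a weighted entire function. After
recentring, the weight is a radial Gaussian, and the circle means of `|H|²` increase with the
radius, so the mass in the lagoon is bounded by a ratio of Gaussian masses times the mass in the
annulus (`lintegral_disc_le_lintegral_annulus`). That ratio yields the factor `exp (π r²/2)`. -/

namespace GaborPhase

/-! ### Polar coordinates and the Poincaré inequality on an annulus -/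

open Real in
theorem lintegral_norm_sub_mem (z₀ : ℂ) {T : Set ℝ} (hT : MeasurableSet T) (hT0 : T ⊆ Ioi 0)
    {f : ℂ → ℝ≥0∞} (hf : Measurable f) :
    ∫⁻ z in {z | ‖z - z₀‖ ∈ T}, f z =
      ∫⁻ t in T, ENNReal.ofReal t * ∫⁻ θ in Ioo (-π) π, f (circleMap z₀ t θ) := by
  have hS : MeasurableSet {z : ℂ | ‖z - z₀‖ ∈ T} := by
    have : Measurable fun z : ℂ => ‖z - z₀‖ := by fun_prop
    exact this hT
  have hm : Measurable fun p : ℝ × ℝ => ENNReal.ofReal p.1 *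
      T.indicator (fun _ => f (circleMap z₀ p.1 p.2)) p.1 := by
    have h1 : Measurable fun p : ℝ × ℝ => f (circleMap z₀ p.1 p.2) := by
      refine hf.comp ?_
      unfold circleMap
      fun_prop
    have : (fun p : ℝ × ℝ => T.indicator (fun _ => f (circleMap z₀ p.1 p.2)) p.1) =
        (Prod.fst ⁻¹' T).indicator (fun p : ℝ × ℝ => f (circleMap z₀ p.1 p.2)) := by
      ext p
      by_cases hp : p.1 ∈ T
      · rw [indicator_of_mem hp, indicator_of_mem (mem_preimage.2 hp)]
      · rw [indicator_of_notMem hp, indicator_of_notMem (mt mem_preimage.1 hp)]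
    refine Measurable.mul (by fun_prop) ?_
    rw [this]
    exact h1.indicator (measurable_fst hT)
  calc ∫⁻ z in {z | ‖z - z₀‖ ∈ T}, f z
      = ∫⁻ z, {z | ‖z - z₀‖ ∈ T}.indicator f z := (lintegral_indicator hS f).symm
    _ = ∫⁻ z, {z | ‖z - z₀‖ ∈ T}.indicator f (z₀ + z) := (lintegral_add_left_eq_self _ z₀).symm
    _ = ∫⁻ p in polarCoord.target, ENNReal.ofReal p.1 *
          T.indicator (fun _ => f (circleMap z₀ p.1 p.2)) p.1 := by
        rw [← Complex.lintegral_comp_polarCoord_symm]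
        refine setLIntegral_congr_fun polarCoord.open_target.measurableSet fun p hp => ?_
        have hp1 : 0 < p.1 := hp.1
        have h1 : z₀ + Complex.polarCoord.symm p = circleMap z₀ p.1 p.2 := by
          rw [Complex.polarCoord_symm_apply, circleMap, Complex.exp_mul_I]
          push_cast; ring
        have h2 : ‖circleMap z₀ p.1 p.2 - z₀‖ = p.1 := by
          simp [circleMap_sub_center, abs_of_pos hp1]
        have h3 : z₀ + Complex.polarCoord.symm p ∈ {z : ℂ | ‖z - z₀‖ ∈ T} ↔ p.1 ∈ T := by
          rw [h1, mem_ofPred_eq, h2]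
        simp only [smul_eq_mul]
        by_cases hT : p.1 ∈ T
        · rw [indicator_of_mem hT, indicator_of_mem (h3.2 hT), h1]
        · rw [indicator_of_notMem hT, indicator_of_notMem (mt h3.1 hT)]
    _ = ∫⁻ t in Ioi 0, ∫⁻ θ in Ioo (-π) π, ENNReal.ofReal t *
          T.indicator (fun _ => f (circleMap z₀ t θ)) t := by
        rw [polarCoord_target, Measure.volume_eq_prod, ← Measure.prod_restrict,
          lintegral_prod _ hm.aemeasurable]
    _ = ∫⁻ t in Ioi 0, T.indicator (fun t => ENNReal.ofReal t *
          ∫⁻ θ in Ioo (-π) π, f (circleMap z₀ t θ)) t := by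
        refine lintegral_congr fun t => ?_
        by_cases ht : t ∈ T
        · simp only [indicator_of_mem ht]
          exact lintegral_const_mul _ (hf.comp (continuous_circleMap z₀ t).measurable)
        · simp [indicator_of_notMem ht]
    _ = _ := by
        rw [lintegral_indicator hT, Measure.restrict_restrict hT, inter_eq_left.2 hT0]

open Real in
/-- A Wirtinger inequality on the circle, with a constant that is not sharp. -/
theorem lintegral_sub_average_sq_le {v : ℝ → ℂ} (hv : ContDiff ℝ 1 v) :
    ∫⁻ θ in Ioo (-π) π, ‖v θ - (2 * π : ℝ)⁻¹ • ∫ φ in (-π)..π, v φ‖ₑ ^ 2 ≤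
      ENNReal.ofReal ((2 * π) ^ 2) * ∫⁻ θ in Ioo (-π) π, ‖deriv v θ‖ₑ ^ 2 := by
  have hpi := Real.pi_pos
  have hd : Continuous (deriv v) := hv.continuous_deriv le_rfl
  set J := ∫⁻ θ in Ioo (-π) π, ‖deriv v θ‖ₑ with hJ
  have hJ' : J = ∫⁻ θ in Icc (-π) π, ‖deriv v θ‖ₑ := by
    rw [hJ, Measure.restrict_congr_set Ioo_ae_eq_Icc]
  have hJtop : J ≠ ⊤ := by
    rw [hJ']
    exact (hd.continuousOn.integrableOn_compact isCompact_Icc).2.ne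
  have h1 : ∀ a ∈ Icc (-π) π, ∀ b ∈ Icc (-π) π, a ≤ b → ‖v b - v a‖ₑ ≤ J := by
    intro a ha b hb hab
    refine (enorm_sub_le_lintegral_deriv_of_contDiffOn_Icc hv.contDiffOn hab).trans ?_
    rw [hJ']
    exact lintegral_mono_set (Icc_subset_Icc ha.1 hb.2)
  have h2 : ∀ a ∈ Icc (-π) π, ∀ b ∈ Icc (-π) π, ‖v b - v a‖ ≤ J.toReal := by
    intro a ha b hb
    have : ‖v b - v a‖ₑ ≤ J := by
      rcases le_total a b with h | h
      · exact h1 a ha b hb h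
      · rw [← neg_sub, enorm_neg]; exact h1 b hb a ha h
    rw [← toReal_enorm]
    exact ENNReal.toReal_mono hJtop this
  -- The deviation from the mean is the average over `φ` of `v θ - v φ`, and each such difference is
  -- at most the total variation `J`.
  have h3 : ∀ θ ∈ Ioo (-π) π, ‖v θ - (2 * π : ℝ)⁻¹ • ∫ φ in (-π)..π, v φ‖ₑ ≤ J := by
    intro θ hθ
    have hint : IntervalIntegrable v volume (-π) π := hv.continuous.intervalIntegrable _ _
    have e1 : v θ - (2 * π : ℝ)⁻¹ • ∫ φ in (-π)..π, v φ =
        (2 * π : ℝ)⁻¹ • ∫ φ in (-π)..π, (v θ - v φ) := by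
      rw [intervalIntegral.integral_sub (by simp) hint, intervalIntegral.integral_const, smul_sub,
        smul_smul]
      have : (2 * π)⁻¹ * (π - -π) = 1 := by field_simp; ring
      rw [this, one_smul]
    have e2 : ‖∫ φ in (-π)..π, (v θ - v φ)‖ ≤ J.toReal * |π - -π| := by
      refine intervalIntegral.norm_integral_le_of_norm_le_const fun φ hφ => ?_
      rw [uIoc_of_le (by linarith)] at hφ
      exact h2 φ (Ioc_subset_Icc_self hφ) θ (Ioo_subset_Icc_self hθ)
    have e3 : ‖v θ - (2 * π : ℝ)⁻¹ • ∫ φ in (-π)..π, v φ‖ ≤ J.toReal := by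
      rw [e1, norm_smul, Real.norm_of_nonneg (by positivity)]
      have : |π - -π| = 2 * π := by rw [abs_of_pos (by linarith)]; ring
      rw [this] at e2
      calc _ ≤ (2 * π)⁻¹ * (J.toReal * (2 * π)) := by gcongr
        _ = _ := by field_simp
    rw [← ofReal_norm]
    exact ENNReal.ofReal_le_of_le_toReal e3
  have hvol : volume (Ioo (-π) π) = ENNReal.ofReal (2 * π) := by
    rw [Real.volume_Ioo]; congr 1; ring
  -- Cauchy–Schwarz on an interval of length `2π`; integrating the constant `J ^ 2` over it supplies
  -- the second factor `2π`.
  have hCS : J ^ 2 ≤ ENNReal.ofReal (2 * π) * ∫⁻ θ in Ioo (-π) π, ‖deriv v θ‖ₑ ^ 2 := by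
    have := ENNReal.lintegral_mul_le_Lp_mul_Lq (volume.restrict (Ioo (-π) π))
      Real.HolderConjugate.two_two (f := fun _ => 1) (g := fun θ => ‖deriv v θ‖ₑ)
      aemeasurable_const (by fun_prop)
    rw [show ∫⁻ a in Ioo (-π) π, ((fun _ => 1) * fun θ => ‖deriv v θ‖ₑ : ℝ → ℝ≥0∞) a = J by
      simp [hJ]] at this
    simp only [one_mul, ENNReal.one_rpow, lintegral_const, Measure.restrict_apply,
      MeasurableSet.univ, univ_inter, hvol] at this
    calc J ^ 2 ≤ (ENNReal.ofReal (2 * π) ^ (1 / 2 : ℝ) *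
          (∫⁻ θ in Ioo (-π) π, ‖deriv v θ‖ₑ ^ 2) ^ (1 / 2 : ℝ)) ^ 2 := by
          gcongr; simpa using this
      _ = _ := by
        rw [mul_pow, ← ENNReal.rpow_natCast, ← ENNReal.rpow_natCast, ← ENNReal.rpow_mul,
          ← ENNReal.rpow_mul]
        norm_num
  calc ∫⁻ θ in Ioo (-π) π, ‖v θ - (2 * π : ℝ)⁻¹ • ∫ φ in (-π)..π, v φ‖ₑ ^ 2
      ≤ ∫⁻ θ in Ioo (-π) π, J ^ 2 :=
        setLIntegral_mono measurable_const fun θ hθ => by gcongr; exact h3 θ hθ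
    _ = J ^ 2 * ENNReal.ofReal (2 * π) := by simp [hvol]
    _ ≤ (ENNReal.ofReal (2 * π) * ∫⁻ θ in Ioo (-π) π, ‖deriv v θ‖ₑ ^ 2) *
          ENNReal.ofReal (2 * π) := by gcongr
    _ = _ := by
        rw [ENNReal.ofReal_pow (by positivity)]; ring

/-- The average is `(2πi)⁻¹ ∮ u(z)/(z - z₀) dz`, so Cauchy's theorem between the two circles
applies. One constant thus serves as mean on all circles, and no radial estimate is needed. -/
theorem circleAverage_eq_of_differentiableOn_annulus {z₀ : ℂ} {r s : ℝ} (hr : 0 ≤ r) {u : ℂ → ℂ}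
    (hu : DifferentiableOn ℂ u {z | ‖z - z₀‖ ∈ Ioo r s}) {t₁ t₂ : ℝ} (h₁ : t₁ ∈ Ioo r s)
    (h₂ : t₂ ∈ Ioo r s) : Real.circleAverage u z₀ t₁ = Real.circleAverage u z₀ t₂ := by
  wlog h : t₁ ≤ t₂ generalizing t₁ t₂
  · exact (this h₂ h₁ (le_of_not_ge h)).symm
  have hsub : Metric.closedBall z₀ t₂ \ Metric.ball z₀ t₁ ⊆ {z | ‖z - z₀‖ ∈ Ioo r s} := by
    rintro z ⟨h1, h2⟩
    rw [mem_closedBall_iff_norm] at h1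
    rw [mem_ball_iff_norm, not_lt] at h2
    exact ⟨h₁.1.trans_le h2, h1.trans_lt h₂.2⟩
  have ho : IsOpen {z : ℂ | ‖z - z₀‖ ∈ Ioo r s} :=
    isOpen_Ioo.preimage (by fun_prop : Continuous fun z : ℂ => ‖z - z₀‖)
  have ht₁ : 0 < t₁ := hr.trans_lt h₁.1
  have := Complex.circleIntegral_sub_center_inv_smul_eq_of_differentiable_on_annulus_off_countable
    ht₁ h countable_empty (f := u) (c := z₀) (hu.continuousOn.mono hsub) (by
      rintro z ⟨⟨h1, h2⟩, -⟩
      refine hu.differentiableAt (ho.mem_nhds (hsub ⟨Metric.ball_subset_closedBall h1, fun h => h2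
        (Metric.ball_subset_closedBall h)⟩)))
  rw [Real.circleAverage_eq_circleIntegral ht₁.ne',
    Real.circleAverage_eq_circleIntegral (ht₁.trans_le h).ne']
  simp only [smul_eq_mul] at this ⊢
  rw [this]

open Real in
/-- A Poincaré inequality for holomorphic functions on an annulus, with a constant that does not
depend on the inner radius. -/
theorem exists_lintegral_sub_sq_le_lintegral_deriv {z₀ : ℂ} {r s : ℝ} (hr : 0 ≤ r) (hrs : r < s)
    {u : ℂ → ℂ} (hum : Measurable u) (hu : DifferentiableOn ℂ u {z | ‖z - z₀‖ ∈ Ioo r s}) :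
    ∃ m : ℂ, ∫⁻ z in {z | ‖z - z₀‖ ∈ Ioo r s}, ‖u z - m‖ₑ ^ 2 ≤
      ENNReal.ofReal ((2 * π * s) ^ 2) *
        ∫⁻ z in {z | ‖z - z₀‖ ∈ Ioo r s}, ‖deriv u z‖ₑ ^ 2 := by
  obtain ⟨t₀, ht₀⟩ : (Ioo r s).Nonempty := nonempty_Ioo.2 hrs
  have ho : IsOpen {z : ℂ | ‖z - z₀‖ ∈ Ioo r s} :=
    isOpen_Ioo.preimage (by fun_prop : Continuous fun z : ℂ => ‖z - z₀‖)
  have hT0 : Ioo r s ⊆ Ioi 0 := fun t ht => hr.trans_lt ht.1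
  refine ⟨Real.circleAverage u z₀ t₀, ?_⟩
  rw [lintegral_norm_sub_mem z₀ measurableSet_Ioo hT0 (by fun_prop),
    lintegral_norm_sub_mem z₀ measurableSet_Ioo hT0 (by
      have := measurable_deriv u
      fun_prop), ← lintegral_const_mul' _ _ ENNReal.ofReal_ne_top]
  refine setLIntegral_mono' measurableSet_Ioo fun t ht => ?_
  have ht0 : 0 < t := hT0 ht
  set v : ℝ → ℂ := fun θ => u (circleMap z₀ t θ) with hv
  have hmem : ∀ θ, circleMap z₀ t θ ∈ {z : ℂ | ‖z - z₀‖ ∈ Ioo r s} := fun θ => by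
    simpa [circleMap_sub_center, abs_of_pos ht0] using ht
  have hvC : ContDiff ℝ 1 v := by
    refine contDiff_iff_contDiffAt.2 fun θ => ?_
    have h1 : ContDiffAt ℂ 1 u (circleMap z₀ t θ) :=
      (hu.contDiffOn ho).contDiffAt (ho.mem_nhds (hmem θ))
    exact h1.restrict_scalars ℝ |>.comp θ (contDiff_circleMap z₀ t).contDiffAt
  -- The angular derivative carries the factor `t < s`, which turns the constant `2π` of the circle
  -- into `2πs`.
  have hvd : ∀ θ, ‖deriv v θ‖ₑ = ENNReal.ofReal t * ‖deriv u (circleMap z₀ t θ)‖ₑ := by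
    intro θ
    have h1 := (hu.differentiableAt (ho.mem_nhds (hmem θ))).hasDerivAt
    have h2 := h1.scomp θ (hasDerivAt_circleMap z₀ t θ)
    have h3 : deriv v θ = _ := h2.deriv
    rw [h3, smul_eq_mul, enorm_mul]
    congr 1
    rw [← ofReal_norm]
    simp [abs_of_pos ht0]
  have hm : Real.circleAverage u z₀ t₀ = (2 * π : ℝ)⁻¹ • ∫ φ in (-π)..π, v φ := by
    rw [circleAverage_eq_of_differentiableOn_annulus hr hu ht₀ ht,
      Real.circleAverage_eq_integral_add (-π)]
    congr 1
    rw [intervalIntegral.integral_comp_add_right (fun θ => u (circleMap z₀ t θ))]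
    rw [zero_add, show 2 * π + -π = π by ring]
  have hW := lintegral_sub_average_sq_le hvC
  rw [← hm] at hW
  simp only [hvd, mul_pow] at hW
  rw [lintegral_const_mul' _ _ (by finiteness)] at hW
  set I := ∫⁻ θ in Ioo (-π) π, ‖deriv u (circleMap z₀ t θ)‖ₑ ^ 2
  calc _ ≤ ENNReal.ofReal t * (ENNReal.ofReal (2 ^ 2 * π ^ 2) * (ENNReal.ofReal t ^ 2 * I)) := by
        gcongr
    _ ≤ ENNReal.ofReal t * (ENNReal.ofReal (2 ^ 2 * π ^ 2) * (ENNReal.ofReal s ^ 2 * I)) := by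
        gcongr; exact ht.2.le
    _ = _ := by
        have : (2 * π * s) ^ 2 = (2 ^ 2 * π ^ 2) * s ^ 2 := by ring
        rw [this, ENNReal.ofReal_mul (p := 2 ^ 2 * π ^ 2) (by positivity),
          ENNReal.ofReal_pow (p := s) (hr.trans hrs.le)]
        ring

/-! ### Growth of circle means: from the annulus into the lagoon -/

open Real in
theorem differentiable_circle_inner {H : ℂ → ℂ} (hH : Differentiable ℂ H) (z₀ : ℂ) {g : ℝ → ℂ}
    (hg : Continuous g) :
    Differentiable ℂ fun ζ : ℂ => ∫ θ in (-π)..π, H (z₀ + ζ * Complex.exp (θ * Complex.I)) * g θ := by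
  intro ζ₀
  have hH' : Continuous (deriv H) := (hH.contDiff (n := 1)).continuous_deriv le_rfl
  obtain ⟨B₁, hB₁⟩ := (isCompact_closedBall z₀ (‖ζ₀‖ + 1)).exists_bound_of_continuousOn
    hH'.continuousOn
  obtain ⟨B₂, hB₂⟩ := (isCompact_uIcc (a := -π) (b := π)).exists_bound_of_continuousOn
    hg.continuousOn
  have hexp : ∀ θ : ℝ, ‖Complex.exp (θ * Complex.I)‖ = 1 := Complex.norm_exp_ofReal_mul_I
  have hcont : ∀ ζ : ℂ, Continuous fun θ : ℝ => z₀ + ζ * Complex.exp (θ * Complex.I) := by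
    intro ζ; fun_prop
  refine (intervalIntegral.hasDerivAt_integral_of_dominated_loc_of_deriv_le (𝕜 := ℂ)
    (μ := volume) (a := -π) (b := π) (s := Metric.ball ζ₀ 1) (x₀ := ζ₀)
    (F := fun ζ θ => H (z₀ + ζ * Complex.exp (θ * Complex.I)) * g θ)
    (F' := fun ζ θ => deriv H (z₀ + ζ * Complex.exp (θ * Complex.I)) *
      Complex.exp (θ * Complex.I) * g θ)
    (bound := fun _ => B₁ * B₂)
    (Metric.ball_mem_nhds _ one_pos) ?_ ?_ ?_ ?_ ?_ ?_).2.differentiableAt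
  · exact Filter.Eventually.of_forall fun ζ =>
      ((hH.continuous.comp (hcont ζ)).mul hg).aestronglyMeasurable
  · exact ((hH.continuous.comp (hcont ζ₀)).mul hg).intervalIntegrable _ _
  · exact (((hH'.comp (hcont ζ₀)).mul (by fun_prop)).mul hg).aestronglyMeasurable
  · refine Filter.Eventually.of_forall fun θ hθ ζ hζ => ?_
    rw [norm_mul, norm_mul, hexp, mul_one]
    have h1 : z₀ + ζ * Complex.exp (θ * Complex.I) ∈ Metric.closedBall z₀ (‖ζ₀‖ + 1) := by
      rw [mem_closedBall_iff_norm, add_sub_cancel_left, norm_mul, hexp, mul_one]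
      have : ‖ζ - ζ₀‖ < 1 := by rwa [← mem_ball_iff_norm]
      have := norm_le_norm_add_norm_sub' ζ ζ₀
      linarith
    exact mul_le_mul (hB₁ _ h1) (hB₂ _ (uIoc_subset_uIcc hθ)) (norm_nonneg _)
      ((norm_nonneg _).trans (hB₁ _ h1))
  · simp
  · refine Filter.Eventually.of_forall fun θ _ ζ _ => ?_
    have h1 : HasDerivAt (fun ζ : ℂ => z₀ + ζ * Complex.exp (θ * Complex.I))
        (Complex.exp (θ * Complex.I)) ζ := by
      simpa using ((hasDerivAt_id ζ).mul_const (Complex.exp (θ * Complex.I))).const_add z₀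
    exact ((hH _).hasDerivAt.comp ζ h1).mul_const _

open Real in
-- Maximum principle for the entire function `K ζ = ∫ H(z₀ + ζ e^{iθ}) conj (H(z₀ + t₁ e^{iθ})) dθ`.
-- With `M t` the integral at radius `t`, `K t₁ = M t₁`, while `|K| ≤ (M t₂ + M t₁)/2` on `|ζ| = t₂`
-- by `2ab ≤ a² + b²` and rotation invariance.
theorem integral_norm_sq_circleMap_mono {H : ℂ → ℂ} (hH : Differentiable ℂ H) (z₀ : ℂ) {t₁ t₂ : ℝ}
    (h₀ : 0 < t₁) (h : t₁ ≤ t₂) :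
    ∫ θ in (-π)..π, ‖H (circleMap z₀ t₁ θ)‖ ^ 2 ≤ ∫ θ in (-π)..π, ‖H (circleMap z₀ t₂ θ)‖ ^ 2 := by
  have hpi := Real.pi_pos
  have hc : ∀ t, Continuous fun θ => H (circleMap z₀ t θ) := fun t =>
    hH.continuous.comp (continuous_circleMap z₀ t)
  set M : ℝ → ℝ := fun t => ∫ θ in (-π)..π, ‖H (circleMap z₀ t θ)‖ ^ 2 with hM
  set K : ℂ → ℂ := fun ζ => ∫ θ in (-π)..π, H (z₀ + ζ * Complex.exp (θ * Complex.I)) *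
    conj (H (circleMap z₀ t₁ θ)) with hK
  have hKd : Differentiable ℂ K := differentiable_circle_inner hH z₀
    (g := fun θ => conj (H (circleMap z₀ t₁ θ))) (Complex.continuous_conj.comp (hc t₁))
  have hK1 : K t₁ = (M t₁ : ℂ) := by
    simp only [hK, hM]
    rw [← intervalIntegral.integral_ofReal]
    refine intervalIntegral.integral_congr fun θ _ => ?_
    simp only [circleMap]
    rw [Complex.mul_conj, Complex.normSq_eq_norm_sq]
  have hshift : ∀ β : ℝ, ∫ θ in (-π)..π, ‖H (circleMap z₀ t₂ (θ + β))‖ ^ 2 = M t₂ := by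
    intro β
    have hper : Function.Periodic (fun θ => ‖H (circleMap z₀ t₂ θ)‖ ^ 2) (2 * π) := fun θ => by
      simp only [periodic_circleMap z₀ t₂ θ]
    rw [intervalIntegral.integral_comp_add_right (fun θ => ‖H (circleMap z₀ t₂ θ)‖ ^ 2)]
    have := hper.intervalIntegral_add_eq (-π + β) (-π)
    rw [show -π + β + 2 * π = π + β by ring, show -π + 2 * π = π by ring] at this
    exact this
  have hbd : ∀ ζ ∈ frontier (Metric.ball (0 : ℂ) t₂), ‖K ζ‖ ≤ (M t₂ + M t₁) / 2 := by
    intro ζ hζ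
    rw [frontier_ball 0 (h₀.trans_le h).ne', mem_sphere_zero_iff_norm] at hζ
    have hz : ∀ θ : ℝ, z₀ + ζ * Complex.exp (θ * Complex.I) = circleMap z₀ t₂ (θ + ζ.arg) := by
      intro θ
      rw [circleMap, ← hζ]
      nth_rewrite 1 [← Complex.norm_mul_exp_arg_mul_I ζ]
      push_cast
      rw [add_mul, Complex.exp_add]
      ring
    have i1 : IntervalIntegrable (fun θ => ‖H (circleMap z₀ t₂ (θ + ζ.arg))‖ ^ 2) volume (-π) π :=
      (((hc t₂).comp (continuous_add_const ζ.arg)).norm.pow 2).intervalIntegrable _ _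
    have i2 : IntervalIntegrable (fun θ => ‖H (circleMap z₀ t₁ θ)‖ ^ 2) volume (-π) π :=
      ((hc t₁).norm.pow 2).intervalIntegrable _ _
    calc ‖K ζ‖ ≤ ∫ θ in (-π)..π, (‖H (circleMap z₀ t₂ (θ + ζ.arg))‖ ^ 2 +
            ‖H (circleMap z₀ t₁ θ)‖ ^ 2) / 2 := by
          refine intervalIntegral.norm_integral_le_of_norm_le (by linarith)
            (Filter.Eventually.of_forall fun θ _ => ?_) ((i1.add i2).div_const 2)
          rw [hz, norm_mul, RCLike.norm_conj]
          nlinarith [sq_nonneg (‖H (circleMap z₀ t₂ (θ + ζ.arg))‖ - ‖H (circleMap z₀ t₁ θ)‖)]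
      _ = (M t₂ + M t₁) / 2 := by
          rw [intervalIntegral.integral_div, intervalIntegral.integral_add i1 i2, hshift]
  have hmax := Complex.norm_le_of_forall_mem_frontier_norm_le Metric.isBounded_ball
    hKd.diffContOnCl hbd (z := (t₁ : ℂ)) (by
      rw [closure_ball _ (h₀.trans_le h).ne', mem_closedBall_zero_iff, Complex.norm_real,
        Real.norm_of_nonneg h₀.le]
      exact h)
  rw [hK1, Complex.norm_real] at hmax
  have := (le_abs_self _).trans hmax
  change M t₁ ≤ M t₂
  linarith

open Real in
theorem lintegral_enorm_sq_circleMap_mono {H : ℂ → ℂ} (hH : Differentiable ℂ H) (z₀ : ℂ)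
    {t₁ t₂ : ℝ} (h₀ : 0 < t₁) (h : t₁ ≤ t₂) :
    ∫⁻ θ in Ioo (-π) π, ‖H (circleMap z₀ t₁ θ)‖ₑ ^ 2 ≤
      ∫⁻ θ in Ioo (-π) π, ‖H (circleMap z₀ t₂ θ)‖ₑ ^ 2 := by
  have hpi := Real.pi_pos
  have key : ∀ t, ∫⁻ θ in Ioo (-π) π, ‖H (circleMap z₀ t θ)‖ₑ ^ 2 =
      ENNReal.ofReal (∫ θ in (-π)..π, ‖H (circleMap z₀ t θ)‖ ^ 2) := by
    intro t
    have hc : Continuous fun θ => ‖H (circleMap z₀ t θ)‖ ^ 2 :=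
      (hH.continuous.comp (continuous_circleMap z₀ t)).norm.pow 2
    rw [intervalIntegral.integral_of_le (by linarith), ofReal_integral_eq_lintegral_ofReal
      ((hc.integrableOn_Icc).mono_set Ioc_subset_Icc_self)
      (Filter.Eventually.of_forall fun θ => by positivity),
      Measure.restrict_congr_set Ioo_ae_eq_Ioc]
    refine lintegral_congr fun θ => ?_
    rw [ENNReal.ofReal_pow (norm_nonneg _), ofReal_norm]
  rw [key, key]
  exact ENNReal.ofReal_le_ofReal (integral_norm_sq_circleMap_mono hH z₀ h₀ h)

open Real in
theorem lintegral_Ioc_mul_exp_neg_pi_sq {a b : ℝ} (ha : 0 ≤ a) (hab : a ≤ b) :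
    ∫⁻ t in Ioc a b, ENNReal.ofReal (t * rexp (-(π * t ^ 2))) =
      ENNReal.ofReal ((rexp (-(π * a ^ 2)) - rexp (-(π * b ^ 2))) / (2 * π)) := by
  have hpi := Real.pi_pos
  have hc : Continuous fun t : ℝ => t * rexp (-(π * t ^ 2)) := by fun_prop
  rw [← ofReal_integral_eq_lintegral_ofReal ((hc.integrableOn_Icc).mono_set Ioc_subset_Icc_self)
    ((ae_restrict_mem measurableSet_Ioc).mono fun t ht =>
      mul_nonneg (ha.trans ht.1.le) (Real.exp_nonneg _)), ← intervalIntegral.integral_of_le hab]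
  congr 1
  have hder : ∀ t ∈ uIcc a b, HasDerivAt (fun t => -(rexp (-(π * t ^ 2)) / (2 * π)))
      (t * rexp (-(π * t ^ 2))) t := by
    intro t _
    have h1 : HasDerivAt (fun t : ℝ => -(π * t ^ 2)) (-(π * (2 * t))) t := by
      convert! ((hasDerivAt_pow 2 t).const_mul π).neg using 1
      norm_num
    convert! (h1.exp.div_const (2 * π)).neg using 1
    field_simp
  rw [intervalIntegral.integral_eq_sub_of_hasDerivAt hder (hc.intervalIntegrable _ _)]
  ring

open Real in
/-- Over the disc of radius `r`, the Gaussian-weighted `L²` norm of an entire function is controlled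
by that over the annulus between the radii `r` and `s`. -/
theorem lintegral_disc_le_lintegral_annulus {H : ℂ → ℂ} (hH : Differentiable ℂ H) (z₀ : ℂ)
    {r s κ : ℝ} (hr : 0 ≤ r) (hrs : r ≤ s) (hκ : 0 ≤ κ)
    (h : 1 - rexp (-(π * r ^ 2)) ≤ κ * (rexp (-(π * r ^ 2)) - rexp (-(π * s ^ 2)))) :
    ∫⁻ z in {z | ‖z - z₀‖ ∈ Ioc 0 r}, ENNReal.ofReal (rexp (-(π * ‖z - z₀‖ ^ 2))) * ‖H z‖ₑ ^ 2 ≤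
      ENNReal.ofReal κ * ∫⁻ z in {z | ‖z - z₀‖ ∈ Ioo r s},
        ENNReal.ofReal (rexp (-(π * ‖z - z₀‖ ^ 2))) * ‖H z‖ₑ ^ 2 := by
  rcases hr.eq_or_lt with rfl | hr0
  · simp
  have hpi := Real.pi_pos
  have hm : Measurable fun z : ℂ =>
      ENNReal.ofReal (rexp (-(π * ‖z - z₀‖ ^ 2))) * ‖H z‖ₑ ^ 2 := by
    have := hH.continuous.measurable
    fun_prop
  set M : ℝ → ℝ≥0∞ := fun t => ∫⁻ θ in Ioo (-π) π, ‖H (circleMap z₀ t θ)‖ₑ ^ 2 with hM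
  have hpol : ∀ T : Set ℝ, MeasurableSet T → T ⊆ Ioi 0 → ∫⁻ z in {z | ‖z - z₀‖ ∈ T},
      ENNReal.ofReal (rexp (-(π * ‖z - z₀‖ ^ 2))) * ‖H z‖ₑ ^ 2 =
        ∫⁻ t in T, ENNReal.ofReal (t * rexp (-(π * t ^ 2))) * M t := by
    intro T hT hT0
    rw [lintegral_norm_sub_mem z₀ hT hT0 hm]
    refine setLIntegral_congr_fun hT fun t ht => ?_
    have ht0 : 0 < t := hT0 ht
    simp only [circleMap_sub_center, norm_circleMap_zero, abs_of_pos ht0]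
    rw [lintegral_const_mul' _ _ ENNReal.ofReal_ne_top, ENNReal.ofReal_mul ht0.le, mul_assoc]
  rw [hpol _ measurableSet_Ioc fun t ht => ht.1,
    hpol _ measurableSet_Ioo fun t ht => hr0.trans ht.1]
  have hw : Measurable fun t : ℝ => ENNReal.ofReal (t * rexp (-(π * t ^ 2))) := by fun_prop
  -- The circle integral is at most `M r` inside and at least `M r` outside, so only the masses of
  -- the radial weight remain to be compared, which is `h`.
  calc _ ≤ ∫⁻ t in Ioc 0 r, ENNReal.ofReal (t * rexp (-(π * t ^ 2))) * M r :=
        setLIntegral_mono' measurableSet_Ioc fun t ht => by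
          gcongr
          exact lintegral_enorm_sq_circleMap_mono hH z₀ ht.1 ht.2
    _ = ENNReal.ofReal ((1 - rexp (-(π * r ^ 2))) / (2 * π)) * M r := by
        rw [lintegral_mul_const _ hw, lintegral_Ioc_mul_exp_neg_pi_sq le_rfl hr]
        simp
    _ ≤ ENNReal.ofReal (κ * ((rexp (-(π * r ^ 2)) - rexp (-(π * s ^ 2))) / (2 * π))) * M r := by
        rw [← mul_div_assoc]
        gcongr
    _ = ENNReal.ofReal κ * ∫⁻ t in Ioo r s, ENNReal.ofReal (t * rexp (-(π * t ^ 2))) * M r := by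
        rw [lintegral_mul_const _ hw, Measure.restrict_congr_set Ioo_ae_eq_Ioc,
          lintegral_Ioc_mul_exp_neg_pi_sq hr hrs, ENNReal.ofReal_mul hκ, mul_assoc]
    _ ≤ _ := by
        gcongr ENNReal.ofReal κ * ?_
        refine setLIntegral_mono' measurableSet_Ioo fun t ht => ?_
        gcongr
        exact lintegral_enorm_sq_circleMap_mono hH z₀ hr0 ht.1.le

open Real in
-- The left side is at most `π r²`. With `a = π (s² - r²)`, the bracket times `exp (π r²)` is `1 -
-- exp (-a) ≥ a/(1 + a)`. The factor `q = 2π/(1 - r/s)` compensates the smallness of `a` on thin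
-- annuli through `q (s - r) = 2πs`, and `1 + a ≤ π (s² + 1)` accounts for `s + s⁻¹`.
theorem one_sub_exp_neg_pi_sq_le {r s : ℝ} (hr : 0 ≤ r) (hrs : r < s) :
    1 - rexp (-(π * r ^ 2)) ≤
      (r * (2 * π / (1 - r / s)) ^ 2 * (s + s⁻¹) * rexp (π * r ^ 2)) *
        (rexp (-(π * r ^ 2)) - rexp (-(π * s ^ 2))) := by
  have hpi := Real.pi_gt_three
  have hs : 0 < s := hr.trans_lt hrs
  set a := π * (s ^ 2 - r ^ 2) with ha
  have ha0 : 0 < a := mul_pos (by linarith) (by nlinarith)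
  have hA : rexp (π * r ^ 2) * (rexp (-(π * r ^ 2)) - rexp (-(π * s ^ 2))) = 1 - rexp (-a) := by
    rw [mul_sub, ← Real.exp_add, ← Real.exp_add]
    simp only [add_neg_cancel, Real.exp_zero, ha]
    ring_nf
  rw [mul_assoc _ (rexp (π * r ^ 2)), hA]
  have h1 : 1 - rexp (-(π * r ^ 2)) ≤ π * r ^ 2 := by
    have := Real.add_one_le_exp (-(π * r ^ 2)); linarith
  refine h1.trans ?_
  set q := 2 * π / (1 - r / s) with hq
  have h1τ : 0 < 1 - r / s := by rw [sub_pos, div_lt_one hs]; exact hrs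
  have hτ0 : 0 ≤ r / s := by positivity
  have hq2 : 2 * π ≤ q := by
    rw [hq, le_div_iff₀ h1τ]; nlinarith
  -- `1 - exp (-a) ≥ a / (1 + a)`
  have hexp : a / (1 + a) ≤ 1 - rexp (-a) := by
    have h2 := Real.add_one_le_exp a
    have h3 : rexp (-a) ≤ (1 + a)⁻¹ := by
      rw [Real.exp_neg]; exact inv_anti₀ (by linarith) (by linarith)
    have : a / (1 + a) = 1 - (1 + a)⁻¹ := by field_simp; ring
    linarith
  have hqnn : 0 ≤ r * q ^ 2 * (s + s⁻¹) := by positivity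
  refine le_trans ?_ (mul_le_mul_of_nonneg_left hexp hqnn)
  have hsum : π * r ^ 2 * (1 + a) ≤ r * q ^ 2 * (s + s⁻¹) * a := by
    have hqs : q * (s - r) = 2 * π * s := by
      have : s - r ≠ 0 := by linarith
      rw [hq]; field_simp
    have e1 : q * a = 2 * π * s * (π * (s + r)) := by
      rw [ha, ← hqs]; ring
    have e2 : r * q ^ 2 * (s + s⁻¹) * a = r * q * (s + s⁻¹) * (q * a) := by ring
    have e3 : (s + s⁻¹) * s = s ^ 2 + 1 := by field_simp
    have e4 : r * q ^ 2 * (s + s⁻¹) * a = 2 * π * (π * r * (s + r)) * q * (s ^ 2 + 1) := by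
      rw [e2, e1, ← e3]; ring
    rw [e4]
    have f1 : 1 + a ≤ π * (s ^ 2 + 1) := by
      rw [ha]; nlinarith [sq_nonneg r]
    have f2 : r ^ 2 ≤ r * (s + r) := by nlinarith
    calc π * r ^ 2 * (1 + a) ≤ π * (r * (s + r)) * (π * (s ^ 2 + 1)) := by gcongr
      _ ≤ π * (r * (s + r)) * (q * (s ^ 2 + 1)) * (2 * π) := by
          have : 0 ≤ π * (r * (s + r)) := by positivity
          have h5 : π * (s ^ 2 + 1) ≤ q * (s ^ 2 + 1) := by gcongr; linarith
          have h6 : 0 ≤ q * (s ^ 2 + 1) := by positivity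
          nlinarith [mul_le_mul_of_nonneg_left h5 this, mul_nonneg this h6]
      _ = _ := by ring
  rw [mul_div_assoc', le_div_iff₀ (by linarith)]
  exact hsum

/-! ### Gabor transforms as weighted entire functions -/

/-- The entire function `w ↦ ∫ conj (f t) e^{-πt² + 2πtw} dt`. -/
noncomputable def entireTransform (f : ℝ → ℂ) (w : ℂ) : ℂ :=
  ∫ t : ℝ, conj (f t) * Complex.exp (-(Real.pi * (t : ℂ) ^ 2) + 2 * Real.pi * t * w)

/-- Expanding `(t - x)²` isolates `exp (-π x²)`; the rest of the exponent, after conjugation,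
depends on `x` and `y` only through `x + iy`. -/
theorem conj_gabor (f : ℝ → ℂ) (z : ℂ) :
    conj (gabor f z) = Real.exp (-(Real.pi * z.re ^ 2)) * entireTransform f z := by
  rw [gabor, windowedFourier, entireTransform, ← integral_const_mul, ← integral_conj]
  refine integral_congr_ae (Filter.Eventually.of_forall fun t => ?_)
  simp only [map_mul, gaussianWindow, Complex.conj_conj, ← Complex.exp_conj]
  rw [mul_assoc, mul_left_comm ((Real.exp (-(Real.pi * z.re ^ 2)) : ℝ) : ℂ)]
  congr 1
  simp only [Complex.ofReal_exp]
  rw [← Complex.exp_add, ← Complex.exp_add]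
  congr 1
  have hz := Complex.re_add_im z
  have h2 : conj (2 : ℂ) = 2 := map_ofNat _ 2
  simp only [map_neg, map_mul, Complex.conj_ofReal, Complex.conj_I, h2]
  push_cast
  linear_combination (2 * Real.pi * t : ℂ) * hz

open Real in
theorem differentiable_entireTransform {f : ℝ → ℂ} (hf : MemLp f 2 volume) :
    Differentiable ℂ (entireTransform f) := by
  intro w₀
  have hpi := Real.pi_gt_three
  set R := ‖w₀‖ + 1 with hR
  set C := 1 + 2 * π * R with hC
  have hR0 : 0 ≤ R := by positivity
  have hsq : MemLp (fun t : ℝ => rexp (-t ^ 2)) 2 volume := by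
    rw [memLp_two_iff_integrable_sq (by fun_prop)]
    refine (integrable_exp_neg_mul_sq (b := 2) two_pos).congr
      (Filter.Eventually.of_forall fun t => ?_)
    simp only [← Real.exp_nat_mul]
    congr 1; push_cast; ring
  have hint : Integrable (fun t => ‖f t‖ * (2 * π * rexp (C ^ 2) * rexp (-t ^ 2))) := by
    have := (hf.norm.integrable_mul hsq).const_mul (2 * π * rexp (C ^ 2))
    refine this.congr (Filter.Eventually.of_forall fun t => ?_)
    simp only [Pi.mul_apply]; ring
  -- The factor `1 + |t|` covers both the integrand and its `w`-derivative, which brings down `2πt`.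
  -- It is absorbed by `exp |t|`, so the linear growth totals `C |t|`, and the surplus of `π t²`
  -- over `t²` dominates it up to `C²`.
  have hexp : ∀ (w : ℂ) (t : ℝ), ‖w‖ ≤ R →
      (1 + |t|) * ‖Complex.exp (-(π * (t : ℂ) ^ 2) + 2 * π * t * w)‖ ≤
        rexp (C ^ 2) * rexp (-t ^ 2) := by
    intro w t hw
    have hre : (-(π * (t : ℂ) ^ 2) + 2 * π * t * w).re = -(π * t ^ 2) + 2 * π * t * w.re := by
      have h1 : -(π * (t : ℂ) ^ 2) + 2 * π * t * w =
          ((-(π * t ^ 2) : ℝ) : ℂ) + ((2 * π * t : ℝ) : ℂ) * w := by push_cast; ring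
      rw [h1, Complex.add_re, Complex.ofReal_re, Complex.re_ofReal_mul]
    rw [Complex.norm_exp, hre]
    have h2 : t * w.re ≤ |t| * R := (le_abs_self _).trans (by
      rw [abs_mul]; gcongr; exact (Complex.abs_re_le_norm w).trans hw)
    have h3 : 1 + |t| ≤ rexp |t| := by rw [add_comm]; exact Real.add_one_le_exp _
    have h4 : |t| + (-(π * t ^ 2) + 2 * π * t * w.re) ≤ C ^ 2 + -t ^ 2 := by
      have h5 : 2 * π * (t * w.re) ≤ 2 * π * (|t| * R) := by gcongr
      have h6 : C * |t| = |t| + 2 * π * (|t| * R) := by rw [hC]; ring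
      nlinarith [sq_nonneg (2 * |t| - C), sq_abs t, sq_nonneg t, sq_nonneg C]
    calc _ ≤ rexp |t| * rexp (-(π * t ^ 2) + 2 * π * t * w.re) := by gcongr
      _ ≤ _ := by rw [← Real.exp_add, ← Real.exp_add]; exact Real.exp_le_exp.2 h4
  have hmeas : ∀ w : ℂ, AEStronglyMeasurable (fun t : ℝ => conj (f t) *
      Complex.exp (-(π * (t : ℂ) ^ 2) + 2 * π * t * w)) volume := fun w =>
    (Complex.continuous_conj.comp_aestronglyMeasurable hf.1).mul
      (Continuous.aestronglyMeasurable (by fun_prop))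
  refine (hasDerivAt_integral_of_dominated_loc_of_deriv_le (𝕜 := ℂ) (μ := volume)
    (s := Metric.ball w₀ 1) (x₀ := w₀)
    (F := fun w t => conj (f t) * Complex.exp (-(π * (t : ℂ) ^ 2) + 2 * π * t * w))
    (F' := fun w t => conj (f t) * (Complex.exp (-(π * (t : ℂ) ^ 2) + 2 * π * t * w) *
      (2 * π * t)))
    (bound := fun t => ‖f t‖ * (2 * π * rexp (C ^ 2) * rexp (-t ^ 2)))
    (Metric.ball_mem_nhds _ one_pos) ?_ ?_ ?_ ?_ hint ?_).2.differentiableAt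
  · exact Filter.Eventually.of_forall hmeas
  · refine hint.mono (hmeas w₀) (Filter.Eventually.of_forall fun t => ?_)
    rw [norm_mul, RCLike.norm_conj, Real.norm_of_nonneg (by positivity)]
    gcongr
    have h1 := hexp w₀ t (by linarith)
    have h2 : 0 ≤ ‖Complex.exp (-(π * (t : ℂ) ^ 2) + 2 * π * t * w₀)‖ := norm_nonneg _
    have h3 : 0 ≤ rexp (C ^ 2) * rexp (-t ^ 2) := by positivity
    nlinarith [mul_nonneg (abs_nonneg t) h2]
  · exact (Complex.continuous_conj.comp_aestronglyMeasurable hf.1).mul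
      (Continuous.aestronglyMeasurable (by fun_prop))
  · refine Filter.Eventually.of_forall fun t w hw => ?_
    rw [norm_mul, RCLike.norm_conj, norm_mul]
    have hw' : ‖w‖ ≤ R := by
      have : ‖w - w₀‖ < 1 := by rwa [← mem_ball_iff_norm]
      have := norm_le_norm_add_norm_sub' w w₀
      linarith
    have h1 := hexp w t hw'
    have h2 : 0 ≤ ‖Complex.exp (-(π * (t : ℂ) ^ 2) + 2 * π * t * w)‖ := norm_nonneg _
    have h3 : ‖(2 * π * t : ℂ)‖ = 2 * π * |t| := by
      simp [abs_of_pos Real.pi_pos]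
    rw [h3]
    refine mul_le_mul_of_nonneg_left ?_ (norm_nonneg _)
    calc _ = 2 * π * (|t| * ‖Complex.exp (-(π * (t : ℂ) ^ 2) + 2 * π * t * w)‖) := by ring
      _ ≤ 2 * π * (rexp (C ^ 2) * rexp (-t ^ 2)) := by
          refine mul_le_mul_of_nonneg_left ?_ (by positivity)
          linarith
      _ = _ := by ring
  · refine Filter.Eventually.of_forall fun t w _ => ?_
    have h1 : HasDerivAt (fun w : ℂ => -(π * (t : ℂ) ^ 2) + 2 * π * t * w) (2 * π * t : ℂ) w := by
      simpa using ((hasDerivAt_id w).const_mul (2 * π * t : ℂ)).const_add (-(π * (t : ℂ) ^ 2))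
    exact h1.cexp.const_mul _

theorem gabor_eq (f : ℝ → ℂ) (z : ℂ) :
    gabor f z = conj ((Real.exp (-(Real.pi * z.re ^ 2)) : ℂ) * entireTransform f z) := by
  rw [← conj_gabor, Complex.conj_conj]

theorem norm_gabor (f : ℝ → ℂ) (z : ℂ) :
    ‖gabor f z‖ = Real.exp (-(Real.pi * z.re ^ 2)) * ‖entireTransform f z‖ := by
  rw [← RCLike.norm_conj (gabor f z), conj_gabor, norm_mul, Complex.norm_real,
    Real.norm_of_nonneg (Real.exp_nonneg _)]

theorem contDiff_gabor {f : ℝ → ℂ} (hf : MemLp f 2 volume) : ContDiff ℝ 1 (gabor f) := by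
  have h1 : ContDiff ℝ 1 (entireTransform f) :=
    ((differentiable_entireTransform hf).contDiff (n := 1)).restrict_scalars ℝ
  have h2 : ContDiff ℝ 1 fun z : ℂ => (Real.exp (-(Real.pi * z.re ^ 2)) : ℂ) := by
    have : ContDiff ℝ 1 fun z : ℂ => z.re := Complex.reCLM.contDiff
    exact Complex.ofRealCLM.contDiff.comp (Real.contDiff_exp.comp (by fun_prop))
  rw [show gabor f = _ from funext (gabor_eq f)]
  exact Complex.conjCLE.contDiff.comp (h2.mul h1)

/-- After recentring, a weight `e^{-πx²}` on a holomorphic function becomes `e^{-π|z - z₀|²/2}`. -/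
theorem exists_recentered {H : ℂ → ℂ} (hH : Differentiable ℂ H) (z₀ : ℂ) :
    ∃ K : ℂ → ℂ, Differentiable ℂ K ∧ ∀ z,
      (Real.exp (-(Real.pi * z.re ^ 2)) * ‖H z‖) ^ 2 =
        Real.exp (-(Real.pi * ‖z - z₀‖ ^ 2)) * ‖K z‖ ^ 2 := by
  -- Since `(x - x₀)² = (|z - z₀|² + Re (z - z₀)²)/2`, the function `x²` differs from `|z - z₀|²/2`
  -- by the real part of a polynomial, which the holomorphic factor absorbs.
  refine ⟨fun z => Complex.exp (-(Real.pi * (z₀.re : ℂ) ^ 2) -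
    2 * Real.pi * z₀.re * (z - z₀) - Real.pi * (z - z₀) ^ 2 / 2) * H z, by fun_prop, fun z => ?_⟩
  rw [norm_mul, Complex.norm_exp, mul_pow, mul_pow, ← mul_assoc, ← Real.exp_nat_mul,
    ← Real.exp_nat_mul, ← Real.exp_add]
  congr 2
  rw [← Complex.normSq_eq_norm_sq, Complex.normSq_apply]
  have : (-(Real.pi * (z₀.re : ℂ) ^ 2) - 2 * Real.pi * z₀.re * (z - z₀) -
      Real.pi * (z - z₀) ^ 2 / 2).re = -(Real.pi * z₀.re ^ 2) - 2 * Real.pi * z₀.re * (z.re - z₀.re)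
        - Real.pi * ((z.re - z₀.re) ^ 2 - (z.im - z₀.im) ^ 2) / 2 := by
    simp [pow_two]
  rw [this]
  simp only [Complex.sub_re, Complex.sub_im]
  push_cast
  ring

/-! ### Weak gradients of locally Lipschitz functions -/

theorem norm_gradient (u : ℂ → ℝ) (z : ℂ) : ‖gradient u z‖ = ‖fderiv ℝ u z‖ := by
  rw [gradient, LinearIsometryEquiv.norm_map]

theorem gradient_re (u : ℂ → ℝ) (z : ℂ) : (gradient u z).re = fderiv ℝ u z 1 := by
  rw [← inner_gradient_left, Complex.inner]; simp

theorem gradient_im (u : ℂ → ℝ) (z : ℂ) : (gradient u z).im = fderiv ℝ u z Complex.I := by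
  rw [← inner_gradient_left, Complex.inner]; simp

theorem measurable_gradient (u : ℂ → ℝ) : Measurable (gradient u) :=
  (InnerProductSpace.toDual ℝ ℂ).symm.continuous.measurable.comp (measurable_fderiv ℝ u)

/-- Real functions on the plane that are Lipschitz on bounded sets. -/
def LipschitzOnBalls (u : ℂ → ℝ) : Prop := ∀ R : ℝ, ∃ K, LipschitzOnWith K u (Metric.ball 0 R)

namespace LipschitzOnBalls

variable {u : ℂ → ℝ}

theorem exists_lipschitzWith_eqOn (hu : LipschitzOnBalls u) (R : ℝ) :
    ∃ K g, LipschitzWith K g ∧ EqOn u g (Metric.ball 0 R) := by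
  obtain ⟨K, hK⟩ := hu R
  obtain ⟨g, hg, hug⟩ := hK.extend_real
  exact ⟨K, g, hg, hug⟩

theorem norm_gradient_le (hu : LipschitzOnBalls u) (R : ℝ) :
    ∃ K : ℝ, ∀ z ∈ Metric.ball 0 R, ‖gradient u z‖ ≤ K := by
  obtain ⟨K, hK⟩ := hu R
  refine ⟨K, fun z hz => ?_⟩
  rw [norm_gradient]
  exact norm_fderiv_le_of_lipschitzOn ℝ (Metric.isOpen_ball.mem_nhds hz) hK

theorem continuous (hu : LipschitzOnBalls u) : Continuous u := by
  refine continuous_iff_continuousAt.2 fun z => ?_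
  obtain ⟨K, hK⟩ := hu (‖z‖ + 1)
  exact hK.continuousOn.continuousAt (Metric.isOpen_ball.mem_nhds (by simp))

theorem ae_differentiableAt (hu : LipschitzOnBalls u) :
    ∀ᵐ z : ℂ, DifferentiableAt ℝ u z := by
  have h : ∀ n : ℕ, ∀ᵐ z : ℂ, z ∈ Metric.ball (0 : ℂ) n → DifferentiableAt ℝ u z := by
    intro n
    obtain ⟨K, g, hg, hug⟩ := hu.exists_lipschitzWith_eqOn n
    filter_upwards [hg.ae_differentiableAt (μ := volume)] with z hz hzn
    exact hz.congr_of_eventuallyEq (hug.eventuallyEq_of_mem (Metric.isOpen_ball.mem_nhds hzn))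
  filter_upwards [ae_all_iff.2 h] with z hz
  obtain ⟨n, hn⟩ := exists_nat_gt ‖z‖
  exact hz n (by simpa using hn)

theorem locallyIntegrable_gradient (hu : LipschitzOnBalls u) : LocallyIntegrable (gradient u) := by
  intro z
  obtain ⟨K, hK⟩ := hu.norm_gradient_le (‖z‖ + 1)
  refine ⟨Metric.ball 0 (‖z‖ + 1), Metric.isOpen_ball.mem_nhds (by simp), ?_⟩
  exact Measure.integrableOn_of_bounded (M := K) measure_ball_lt_top.ne
    (measurable_gradient u).aestronglyMeasurable
    ((ae_restrict_mem Metric.isOpen_ball.measurableSet).mono hK)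

/-- On a ball containing the support of `φ`, `u` agrees with a globally Lipschitz function; for the
latter, integration by parts holds with line derivatives, which are Fréchet derivatives almost
everywhere by Rademacher. -/
theorem integral_mul_fderiv (hu : LipschitzOnBalls u) {φ : ℂ → ℝ} (hφ : ContDiff ℝ ∞ φ)
    (hc : HasCompactSupport φ) (e : ℂ) :
    ∫ z, u z * fderiv ℝ φ z e = -∫ z, φ z * fderiv ℝ u z e := by
  obtain ⟨R, hR⟩ := hc.isCompact.isBounded.subset_ball 0
  obtain ⟨K, g, hg, hug⟩ := hu.exists_lipschitzWith_eqOn R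
  obtain ⟨D, hD⟩ := ContDiff.lipschitzWith_of_hasCompactSupport hc hφ (by simp)
  have key := hg.integral_lineDeriv_mul_eq (μ := volume) hD hc e
  have e1 : ∫ z, lineDeriv ℝ g z e * φ z = ∫ z, φ z * fderiv ℝ u z e := by
    refine integral_congr_ae ?_
    filter_upwards [hg.ae_differentiableAt (μ := volume)] with z hz
    by_cases h : z ∈ tsupport φ
    · have : u =ᶠ[nhds z] g := hug.eventuallyEq_of_mem (Metric.isOpen_ball.mem_nhds (hR h))
      rw [hz.lineDeriv_eq_fderiv, this.fderiv_eq, mul_comm]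
    · rw [image_eq_zero_of_notMem_tsupport h]; simp
  have e2 : ∫ z, lineDeriv ℝ φ z (-e) * g z = -∫ z, u z * fderiv ℝ φ z e := by
    rw [← integral_neg]
    refine integral_congr_ae (Filter.Eventually.of_forall fun z => ?_)
    have hd : DifferentiableAt ℝ φ z := hφ.differentiable (by simp) z
    simp only [hd.lineDeriv_eq_fderiv, map_neg]
    by_cases h : z ∈ tsupport φ
    · rw [hug (hR h)]; ring
    · have : fderiv ℝ φ z = 0 := by
        by_contra h0
        exact h (support_fderiv_subset ℝ h0)
      simp [this]
  rw [← e1, key, e2, neg_neg]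

theorem isWeakGradient (hu : LipschitzOnBalls u) (U : Set ℂ) :
    IsWeakGradient U u (gradient u) := by
  refine ⟨hu.continuous.locallyIntegrable.locallyIntegrableOn U,
    hu.locallyIntegrable_gradient.locallyIntegrableOn U, fun φ hφ hc hU => ?_⟩
  have hg0 : ∀ z, z ∉ tsupport φ → gradient φ z = 0 := by
    intro z hz
    have : fderiv ℝ φ z = 0 := by
      by_contra h0
      exact hz (support_fderiv_subset ℝ h0)
    rw [gradient, this, map_zero]
  have hgc : Continuous (gradient φ) :=
    (InnerProductSpace.toDual ℝ ℂ).symm.continuous.comp (hφ.continuous_fderiv (by simp))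
  have hgcs : HasCompactSupport (gradient φ) :=
    hc.mono' fun z hz => by_contra fun h => hz (hg0 z h)
  rw [setIntegral_eq_integral_of_forall_compl_eq_zero fun z hz => by
      rw [hg0 z fun h => hz (hU h), smul_zero],
    setIntegral_eq_integral_of_forall_compl_eq_zero fun z hz => by
      rw [image_eq_zero_of_notMem_tsupport fun h => hz (hU h), zero_smul]]
  have i1 : Integrable fun z => u z • gradient φ z :=
    (hu.continuous.smul hgc).integrable_of_hasCompactSupport hgcs.smul_left
  have i2 : Integrable fun z => φ z • gradient u z :=
    hu.locallyIntegrable_gradient.integrable_smul_left_of_hasCompactSupport hφ.continuous hc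
  apply Complex.ext
  · have h1 := Complex.reCLM.integral_comp_comm i1
    have h2 := Complex.reCLM.integral_comp_comm i2
    simp only [Complex.reCLM_apply, Complex.smul_re, gradient_re, smul_eq_mul] at h1 h2
    rw [Complex.neg_re, ← h1, ← h2, hu.integral_mul_fderiv hφ hc]
  · have h1 := Complex.imCLM.integral_comp_comm i1
    have h2 := Complex.imCLM.integral_comp_comm i2
    simp only [Complex.imCLM_apply, Complex.smul_im, gradient_im, smul_eq_mul] at h1 h2
    rw [Complex.neg_im, ← h1, ← h2, hu.integral_mul_fderiv hφ hc]

theorem memSobolev (hu : LipschitzOnBalls u) {U : Set ℂ} (hU : IsOpen U)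
    (hb : Bornology.IsBounded U) : MemSobolev u 2 U := by
  obtain ⟨R, hR⟩ := hb.subset_ball 0
  have : IsFiniteMeasure (volume.restrict U) := ⟨by
    rw [Measure.restrict_apply_univ]
    exact (measure_mono hR).trans_lt measure_ball_lt_top⟩
  obtain ⟨K, hK⟩ := hu.norm_gradient_le R
  obtain ⟨B, hB⟩ := (isCompact_closedBall (0 : ℂ) R).exists_bound_of_continuousOn
    hu.continuous.continuousOn
  refine ⟨MemLp.of_bound hu.continuous.aestronglyMeasurable B ?_, gradient u,
    hu.isWeakGradient U, MemLp.of_bound (measurable_gradient u).aestronglyMeasurable K ?_⟩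
  · filter_upwards [ae_restrict_mem hU.measurableSet] with z hz using
      hB z (Metric.ball_subset_closedBall (hR hz))
  · filter_upwards [ae_restrict_mem hU.measurableSet] with z hz using hK z (hR hz)

end LipschitzOnBalls

/-- The fundamental lemma of the calculus of variations. It allows the infimum in `sobolevNorm` to
be bounded below by the classical gradient. -/
theorem IsWeakGradient.ae_eq {U : Set ℂ} (hU : IsOpen U) {u : ℂ → ℝ} {G₁ G₂ : ℂ → ℂ}
    (h₁ : IsWeakGradient U u G₁) (h₂ : IsWeakGradient U u G₂) :
    G₁ =ᵐ[volume.restrict U] G₂ := by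
  have hint : ∀ G : ℂ → ℂ, LocallyIntegrableOn G U → ∀ φ : ℂ → ℝ, ContDiff ℝ ∞ φ →
      HasCompactSupport φ → tsupport φ ⊆ U → Integrable fun z => φ z • G z := by
    intro G hG φ hφ hc hφU
    have h1 : IntegrableOn (fun z => φ z • G z) (tsupport φ) :=
      (hG.integrableOn_compact_subset hφU hc.isCompact).continuousOn_smul hφ.continuous.continuousOn
        hc.isCompact
    rw [← integrableOn_iff_integrable_of_support_subset (s := tsupport φ)]
    · exact h1
    · intro z hz
      by_contra h
      exact hz (by simp [image_eq_zero_of_notMem_tsupport h])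
  have hU0 : ∀ G : ℂ → ℂ, ∀ φ : ℂ → ℝ, tsupport φ ⊆ U →
      ∫ z in U, φ z • G z = ∫ z, φ z • G z := by
    intro G φ hφU
    exact setIntegral_eq_integral_of_forall_compl_eq_zero fun z hz => by
      rw [image_eq_zero_of_notMem_tsupport fun h => hz (hφU h), zero_smul]
  have := hU.ae_eq_zero_of_integral_contDiff_smul_eq_zero (μ := volume)
    (f := fun z => G₁ z - G₂ z) (h₁.2.1.sub h₂.2.1) (by
      intro φ hφ hc hφU
      have e1 := h₁.2.2 φ hφ hc hφU
      rw [h₂.2.2 φ hφ hc hφU, neg_inj, hU0 _ _ hφU, hU0 _ _ hφU] at e1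
      simp only [smul_sub]
      rw [integral_sub (hint _ h₁.2.1 φ hφ hc hφU) (hint _ h₂.2.1 φ hφ hc hφU), e1, sub_self])
  rw [Filter.EventuallyEq, ae_restrict_iff' hU.measurableSet]
  filter_upwards [this] with z hz hzU
  exact sub_eq_zero.1 (hz hzU)

theorem LipschitzOnBalls.le_sobolevNorm {u : ℂ → ℝ} (hu : LipschitzOnBalls u) {U : Set ℂ}
    (hU : IsOpen U) :
    eLpNorm u 2 (volume.restrict U) + eLpNorm (gradient u) 2 (volume.restrict U) ≤
      sobolevNorm u 2 U :=
  le_iInf₂ fun _ hG => by rw [eLpNorm_congr_ae ((hu.isWeakGradient U).ae_eq hU hG)]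

/-- The modulus is 1-Lipschitz, so the zeros of `F`, where `‖F‖` may fail to be differentiable, do
no harm. -/
theorem lipschitzOnBalls_norm {F : ℂ → ℂ} (hF : ContDiff ℝ 1 F) (R : ℝ) :
    ∃ K, LipschitzOnWith K (fun z => ‖F z‖) (Metric.ball 0 R) := by
  obtain ⟨B, hB⟩ := (isCompact_closedBall (0 : ℂ) R).exists_bound_of_continuousOn
    (hF.continuous_fderiv one_ne_zero).continuousOn
  have h := (convex_ball (0 : ℂ) R).lipschitzOnWith_of_nnnorm_fderiv_le (𝕜 := ℝ)
    (f := F) (C := B.toNNReal) (fun z _ => hF.differentiable one_ne_zero z) (fun z hz => by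
      rw [← NNReal.coe_le_coe, coe_nnnorm]
      exact (hB z (Metric.ball_subset_closedBall hz)).trans (Real.le_coe_toNNReal B))
  exact ⟨_, lipschitzWith_one_norm.comp_lipschitzOnWith h⟩

theorem lipschitzOnBalls_norm_sub_norm {F G : ℂ → ℂ} (hF : ContDiff ℝ 1 F) (hG : ContDiff ℝ 1 G) :
    LipschitzOnBalls fun z => ‖F z‖ - ‖G z‖ := by
  intro R
  obtain ⟨K₁, h₁⟩ := lipschitzOnBalls_norm hF R
  obtain ⟨K₂, h₂⟩ := lipschitzOnBalls_norm hG R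
  exact ⟨_, h₁.sub h₂⟩

/-! ### Derivatives of holomorphic functions and their moduli -/

/-- Off the zeros, the differential of `‖u‖²` is tested in the direction `u z * conj (deriv u z)`,
along which `u` moves radially. At a zero, `‖u‖` has a minimum, so its differential vanishes and
hence so does that of `u`. -/
theorem norm_deriv_le_norm_fderiv_norm {u : ℂ → ℂ} {z : ℂ} (hu : DifferentiableAt ℂ u z)
    (hn : DifferentiableAt ℝ (fun w => ‖u w‖) z) :
    ‖deriv u z‖ ≤ ‖fderiv ℝ (fun w => ‖u w‖) z‖ := by
  by_cases h0 : u z = 0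
  · have hmin : IsLocalMin (fun w => ‖u w‖) z :=
      Filter.Eventually.of_forall fun w => by simp [h0]
    have h1 := hn.hasFDerivAt
    rw [hmin.fderiv_eq_zero] at h1
    have h2 : HasFDerivAt u (0 : ℂ →L[ℂ] ℂ) z := by
      rw [hasFDerivAt_iff_isLittleO] at h1 ⊢
      simpa [h0] using h1
    have h3 : deriv u z = 0 := by
      simpa using h2.hasDerivAt.deriv
    rw [h3, norm_zero]
    exact norm_nonneg _
  · set L := fderiv ℝ (fun w => ‖u w‖) z
    have hu' : HasFDerivAt u ((ContinuousLinearMap.toSpanSingleton ℂ (deriv u z)).restrictScalars ℝ)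
        z := hu.hasDerivAt.hasFDerivAt.restrictScalars ℝ
    have h1 := hu'.norm_sq
    have h2 := hn.hasFDerivAt.pow 2
    have h3 := h1.unique h2
    have h4 := DFunLike.congr_fun h3 (u z * conj (deriv u z))
    simp only [smul_apply, ContinuousLinearMap.comp_apply,
      ContinuousLinearMap.coe_restrictScalars', ContinuousLinearMap.toSpanSingleton_apply,
      innerSL_apply_apply, smul_eq_mul] at h4
    have h5 : inner ℝ (u z) (u z * conj (deriv u z) * deriv u z) =
        ‖u z‖ ^ 2 * ‖deriv u z‖ ^ 2 := by
      rw [mul_assoc, Complex.conj_mul', Complex.inner, mul_right_comm, Complex.mul_conj',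
        ← Complex.ofReal_pow, ← Complex.ofReal_pow, ← Complex.ofReal_mul, Complex.ofReal_re]
    have h6 : L (u z * conj (deriv u z)) ≤ ‖L‖ * (‖u z‖ * ‖deriv u z‖) := by
      refine (le_abs_self _).trans ((L.le_opNorm _).trans_eq ?_)
      rw [norm_mul, RCLike.norm_conj]
    have hpos : 0 < ‖u z‖ := norm_pos_iff.2 h0
    rcases (norm_nonneg (deriv u z)).eq_or_lt with hd | hd
    · rw [← hd]; exact norm_nonneg _
    · have h7 : ‖u z‖ ^ 2 * ‖deriv u z‖ ^ 2 = ‖u z‖ * L (u z * conj (deriv u z)) := by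
        rw [h5] at h4
        simp only [nsmul_eq_mul, Nat.cast_ofNat, Nat.add_one_sub_one, pow_one] at h4
        linarith
      have h8 : ‖u z‖ ^ 2 * ‖deriv u z‖ * ‖deriv u z‖ ≤ ‖u z‖ ^ 2 * ‖deriv u z‖ * ‖L‖ := by
        nlinarith [mul_le_mul_of_nonneg_left h6 hpos.le]
      exact le_of_mul_le_mul_left h8 (by positivity)

/-- The derivative of a holomorphic quotient is controlled by the difference of the moduli. -/
theorem norm_deriv_le_of_norm_eq {u : ℂ → ℂ} {p v : ℂ → ℝ} {z : ℂ} {δ Δ : ℝ} (hδ : 0 < δ)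
    (hδΔ : δ ≤ Δ) (hu : DifferentiableAt ℂ u z) (hp : DifferentiableAt ℝ p z)
    (hv : DifferentiableAt ℝ v z) (huv : ∀ᶠ w in nhds z, p w ≠ 0 ∧ ‖u w‖ = 1 - v w / p w)
    (hpz : δ ≤ p z) (hpΔ : ‖fderiv ℝ p z‖ ≤ Δ) :
    ‖deriv u z‖ ≤ Δ / δ ^ 2 * (|v z| + ‖fderiv ℝ v z‖) := by
  have hn : DifferentiableAt ℝ (fun w => ‖u w‖) z :=
    ((hv.mul (hp.inv huv.self_of_nhds.1)).const_sub 1).congr_of_eventuallyEq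
      (huv.mono fun w hw => by simp [hw.2, div_eq_mul_inv])
  refine (norm_deriv_le_norm_fderiv_norm hu hn).trans ?_
  set L := fderiv ℝ (fun w => ‖u w‖) z
  -- Differentiating `v = p (1 - ‖u‖)` and solving for `p ∇‖u‖` leaves only `∇v` and `(v/p) ∇p`.
  have hprod : v =ᶠ[nhds z] fun w => p w * (1 - ‖u w‖) := huv.mono fun w hw => by
    have := hw.1
    simp only [hw.2]; field_simp; ring
  have h1 := (hp.hasFDerivAt.mul (hn.hasFDerivAt.const_sub 1)).congr_of_eventuallyEq hprod
  have h2 : fderiv ℝ v z = p z • -L + (1 - ‖u z‖) • fderiv ℝ p z := h1.fderiv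
  have hp0 : 0 < p z := hδ.trans_le hpz
  have hu1 : 1 - ‖u z‖ = v z / p z := by rw [huv.self_of_nhds.2]; ring
  have h3 : p z • L = (v z / p z) • fderiv ℝ p z - fderiv ℝ v z := by
    rw [h2, hu1]; module
  have h4 : p z * ‖L‖ ≤ |v z| / p z * Δ + ‖fderiv ℝ v z‖ := by
    calc p z * ‖L‖ = ‖p z • L‖ := by rw [norm_smul, Real.norm_of_nonneg hp0.le]
      _ ≤ ‖(v z / p z) • fderiv ℝ p z‖ + ‖fderiv ℝ v z‖ := by rw [h3]; exact norm_sub_le _ _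
      _ ≤ _ := by
          rw [norm_smul, norm_div, Real.norm_of_nonneg hp0.le, Real.norm_eq_abs]
          gcongr
  have h5 : |v z| / p z * Δ ≤ |v z| / δ * Δ := by
    have : 0 ≤ Δ := hδ.le.trans hδΔ
    gcongr
  have h6 : ‖fderiv ℝ v z‖ ≤ Δ / δ * ‖fderiv ℝ v z‖ :=
    le_mul_of_one_le_left (norm_nonneg _) ((one_le_div hδ).2 hδΔ)
  have h7 : δ * ‖L‖ ≤ Δ / δ * (|v z| + ‖fderiv ℝ v z‖) := by
    have := mul_le_mul_of_nonneg_right hpz (norm_nonneg L)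
    have e : |v z| / δ * Δ = Δ / δ * |v z| := by ring
    linarith
  calc ‖L‖ = (δ * ‖L‖) / δ := by field_simp
    _ ≤ (Δ / δ * (|v z| + ‖fderiv ℝ v z‖)) / δ := by gcongr
    _ = _ := by field_simp

/-! ### Estimates on a single disc -/

theorem eLpNorm_two_le_of_lintegral_le {α β E F : Type*} [MeasurableSpace α] [MeasurableSpace β]
    [NormedAddCommGroup E] [NormedAddCommGroup F] {μ : Measure α} {ν : Measure β} {f : α → E}
    {g : β → F} {c : ℝ} (hc : 0 ≤ c)
    (h : ∫⁻ x, ‖f x‖ₑ ^ 2 ∂μ ≤ ENNReal.ofReal (c ^ 2) * ∫⁻ x, ‖g x‖ₑ ^ 2 ∂ν) :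
    eLpNorm f 2 μ ≤ ENNReal.ofReal c * eLpNorm g 2 ν := by
  have hf := eLpNorm_nnreal_pow_eq_lintegral (f := f) (μ := μ) (p := 2) two_ne_zero
  have hg := eLpNorm_nnreal_pow_eq_lintegral (f := g) (μ := ν) (p := 2) two_ne_zero
  simp only [NNReal.coe_ofNat, ENNReal.rpow_ofNat, ENNReal.coe_ofNat] at hf hg
  rw [← hf, ← hg, ENNReal.ofReal_pow hc, ← mul_pow] at h
  exact (ENNReal.pow_le_pow_left_iff two_ne_zero).1 h

theorem norm_gabor_sub_phase_mul (f g : ℝ → ℂ) (α : ℝ) (z : ℂ) :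
    ‖gabor f z - Complex.exp (Complex.I * α) * gabor g z‖ = Real.exp (-(Real.pi * z.re ^ 2)) *
      ‖entireTransform f z - Complex.exp (-(Complex.I * α)) * entireTransform g z‖ := by
  rw [← RCLike.norm_conj, map_sub, map_mul, conj_gabor, conj_gabor, ← Complex.exp_conj,
    mul_left_comm, ← mul_sub, norm_mul, Complex.norm_real, Real.norm_of_nonneg (Real.exp_nonneg _)]
  simp

open Real in
/-- A bound on the atoll for the difference of two Gabor transforms extends to the lagoon. -/
theorem eLpNorm_ball_le_eLpNorm_annulus {f g : ℝ → ℂ} (hf : MemLp f 2 volume)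
    (hg : MemLp g 2 volume) (α : ℝ) (z₀ : ℂ) {r s κ : ℝ} (hr : 0 ≤ r) (hrs : r ≤ s) (hκ : 0 ≤ κ)
    (h : 1 - rexp (-(π * r ^ 2)) ≤ κ ^ 2 * (rexp (-(π * r ^ 2)) - rexp (-(π * s ^ 2)))) :
    eLpNorm (fun w => gabor f w - Complex.exp (Complex.I * α) * gabor g w) 2
        (volume.restrict (Metric.ball z₀ s)) ≤
      ENNReal.ofReal (1 + κ) *
        eLpNorm (fun w => gabor f w - Complex.exp (Complex.I * α) * gabor g w) 2
          (volume.restrict {z | ‖z - z₀‖ ∈ Ioo r s}) := by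
  set X : ℂ → ℂ := fun w => gabor f w - Complex.exp (Complex.I * α) * gabor g w with hX
  have hH : Differentiable ℂ fun z => entireTransform f z -
      Complex.exp (-(Complex.I * α)) * entireTransform g z :=
    (differentiable_entireTransform hf).sub ((differentiable_entireTransform hg).const_mul _)
  obtain ⟨K, hK, hKX⟩ := exists_recentered hH z₀
  have hXK : ∀ z, ‖X z‖ₑ ^ 2 = ENNReal.ofReal (rexp (-(π * ‖z - z₀‖ ^ 2))) * ‖K z‖ₑ ^ 2 := by
    intro z
    rw [← ofReal_norm, ← ENNReal.ofReal_pow (norm_nonneg _), hX, norm_gabor_sub_phase_mul, hKX,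
      ENNReal.ofReal_mul (Real.exp_nonneg _), ENNReal.ofReal_pow (norm_nonneg _), ofReal_norm]
  refine eLpNorm_two_le_of_lintegral_le (by linarith) ?_
  -- The centre is split off because the polar description omits it; it is a null set.
  have hsub : Metric.ball z₀ s ⊆
      ({z | ‖z - z₀‖ ∈ Ioc 0 r} ∪ {z | ‖z - z₀‖ ∈ Ioo r s}) ∪ {z₀} := by
    intro z hz
    rw [mem_ball_iff_norm] at hz
    by_cases h0 : z = z₀
    · exact Or.inr h0
    · have h1 : 0 < ‖z - z₀‖ := norm_pos_iff.2 (sub_ne_zero.2 h0)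
      rcases le_or_gt ‖z - z₀‖ r with h2 | h2
      · exact Or.inl (Or.inl ⟨h1, h2⟩)
      · exact Or.inl (Or.inr ⟨h2, hz⟩)
  have hlag := lintegral_disc_le_lintegral_annulus hK z₀ hr hrs (sq_nonneg κ) h
  simp only [← hXK] at hlag
  set I := ∫⁻ z in {z | ‖z - z₀‖ ∈ Ioo r s}, ‖X z‖ₑ ^ 2
  calc ∫⁻ z in Metric.ball z₀ s, ‖X z‖ₑ ^ 2
      ≤ ∫⁻ z in ({z | ‖z - z₀‖ ∈ Ioc 0 r} ∪ {z | ‖z - z₀‖ ∈ Ioo r s}) ∪ {z₀}, ‖X z‖ₑ ^ 2 :=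
        lintegral_mono_set hsub
    _ ≤ ∫⁻ z in {z | ‖z - z₀‖ ∈ Ioc 0 r} ∪ {z | ‖z - z₀‖ ∈ Ioo r s}, ‖X z‖ₑ ^ 2 := by
        refine (lintegral_union_le _ _ _).trans_eq ?_
        rw [Measure.restrict_singleton]; simp
    _ ≤ ENNReal.ofReal (κ ^ 2) * I + I :=
        (lintegral_union_le _ _ _).trans (by gcongr)
    _ = ENNReal.ofReal (κ ^ 2 + 1) * I := by
        rw [ENNReal.ofReal_add (by positivity) zero_le_one, ENNReal.ofReal_one, add_mul, one_mul]
    _ ≤ ENNReal.ofReal ((1 + κ) ^ 2) * I := by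
        gcongr
        nlinarith

open Real in
-- With `e = exp (i arg m)`, the difference has modulus `|V f| |u - e|`, and `|u - e| ≤ |u - m| +
-- ||m| - 1| ≤ 2 |u - m| + ||u| - 1|`. The first term falls to Poincaré, the second is at most
-- `|v|/δ`.
theorem exists_phase_eLpNorm_annulus_le {f g : ℝ → ℂ} (hf : MemLp f 2 volume)
    (hg : MemLp g 2 volume) {z₀ : ℂ} {r s δ Δ : ℝ} (hr : 0 ≤ r) (hrs : r < s) (hδ : 0 < δ)
    (hδΔ : δ ≤ Δ) (hf' : IsAtollFunction (gabor f) (Metric.ball z₀ s) (Metric.ball z₀ r) δ Δ) :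
    ∃ α : ℝ, eLpNorm (fun w => gabor f w - Complex.exp (Complex.I * α) * gabor g w) 2
        (volume.restrict {z | ‖z - z₀‖ ∈ Ioo r s}) ≤
      ENNReal.ofReal (Δ ^ 2 / δ ^ 2 * (1 + 4 * π * s)) *
        (eLpNorm (fun w => ‖gabor f w‖ - ‖gabor g w‖) 2
            (volume.restrict {z | ‖z - z₀‖ ∈ Ioo r s}) +
          eLpNorm (gradient fun w => ‖gabor f w‖ - ‖gabor g w‖) 2
            (volume.restrict {z | ‖z - z₀‖ ∈ Ioo r s})) := by
  have hpi := Real.pi_pos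
  have hs : 0 < s := hr.trans_lt hrs
  have hΔ : 0 < Δ := hδ.trans_le hδΔ
  set A : Set ℂ := {z | ‖z - z₀‖ ∈ Ioo r s} with hA
  set v : ℂ → ℝ := fun w => ‖gabor f w‖ - ‖gabor g w‖ with hv
  have hAo : IsOpen A := isOpen_Ioo.preimage (by fun_prop : Continuous fun z : ℂ => ‖z - z₀‖)
  have hAball : A ⊆ Metric.ball z₀ s := fun z hz => mem_ball_iff_norm.2 hz.2
  have hAatoll : A ⊆ atoll (Metric.ball z₀ s) (Metric.ball z₀ r) := fun z hz =>
    ⟨hAball hz, fun h => not_lt.2 (mem_closedBall_iff_norm.1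
      (Metric.closure_ball_subset_closedBall h)) hz.1⟩
  have hlow : ∀ z ∈ A, δ ≤ ‖gabor f z‖ := fun z hz => hf'.le_norm z (hAatoll hz)
  have hEf : ∀ z ∈ A, entireTransform f z ≠ 0 := fun z hz h0 => by
    have := hlow z hz
    rw [norm_gabor, h0, norm_zero, mul_zero] at this
    exact not_le.2 hδ this
  have hdf := differentiable_entireTransform hf
  have hdg := differentiable_entireTransform hg
  have hcf := contDiff_gabor hf
  have hcg := contDiff_gabor hg
  have hvL : LipschitzOnBalls v := lipschitzOnBalls_norm_sub_norm hcf hcg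
  set u : ℂ → ℂ := fun z => entireTransform g z / entireTransform f z with hu
  have hum : Measurable u := hdg.continuous.measurable.div hdf.continuous.measurable
  have hud : DifferentiableOn ℂ u A := fun z hz =>
    ((hdg z).div (hdf z) (hEf z hz)).differentiableWithinAt
  have hnu : ∀ z ∈ A, ‖gabor f z‖ ≠ 0 ∧ ‖u z‖ = 1 - v z / ‖gabor f z‖ := by
    intro z hz
    have h1 : ‖gabor f z‖ ≠ 0 := (hδ.trans_le (hlow z hz)).ne'
    refine ⟨h1, ?_⟩
    have h2 : ‖u z‖ = ‖gabor g z‖ / ‖gabor f z‖ := by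
      rw [hu, norm_gabor, norm_gabor, norm_div, mul_div_mul_left _ _ (Real.exp_pos _).ne']
    rw [h2, hv]
    field_simp
    ring
  obtain ⟨m, hm⟩ := exists_lintegral_sub_sq_le_lintegral_deriv hr hrs hum hud
  -- For `m = 0` the convention `arg 0 = 0` gives `e = 1`, and the estimate holds unchanged.
  refine ⟨m.arg, ?_⟩
  set μ := volume.restrict A with hμ
  have hpoint : ∀ z ∈ A, ‖gabor f z - Complex.exp (Complex.I * m.arg) * gabor g z‖ ≤
      2 * Δ * ‖u z - m‖ + Δ / δ * |v z| := by
    intro z hz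
    set e := Complex.exp (Complex.I * m.arg) with he
    have hme : (‖m‖ : ℂ) * e = m := by
      rw [he, mul_comm Complex.I]; exact Complex.norm_mul_exp_arg_mul_I m
    have hen : ‖e‖ = 1 := by
      rw [he, mul_comm Complex.I]; exact Complex.norm_exp_ofReal_mul_I _
    have h1 : ‖gabor f z - e * gabor g z‖ = ‖gabor f z‖ * ‖u z - e‖ := by
      rw [he, norm_gabor_sub_phase_mul, norm_gabor, mul_assoc, ← he]
      congr 1
      have h2 : entireTransform f z - Complex.exp (-(Complex.I * m.arg)) * entireTransform g z =
          -(Complex.exp (-(Complex.I * m.arg)) * (entireTransform f z * (u z - e))) := by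
        have h3 : Complex.exp (-(Complex.I * m.arg)) * e = 1 := by
          rw [he, ← Complex.exp_add]; simp
        have h4 : entireTransform f z * u z = entireTransform g z :=
          mul_div_cancel₀ _ (hEf z hz)
        linear_combination (-entireTransform f z) * h3 +
          Complex.exp (-(Complex.I * m.arg)) * h4
      have h5 : ‖Complex.exp (-(Complex.I * m.arg))‖ = 1 := by
        rw [Complex.exp_neg, norm_inv, ← he, hen, inv_one]
      rw [h2, norm_neg, norm_mul, h5, one_mul, norm_mul]
    have h6 : ‖m - e‖ = |‖m‖ - 1| := by
      nth_rewrite 1 [← hme]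
      rw [← sub_one_mul, norm_mul, hen, mul_one, ← Complex.ofReal_one, ← Complex.ofReal_sub,
        Complex.norm_real, Real.norm_eq_abs]
    have h7 : |‖m‖ - 1| ≤ ‖u z - m‖ + |v z| / δ := by
      have h8 : |‖u z‖ - 1| ≤ |v z| / δ := by
        rw [(hnu z hz).2, sub_sub_cancel_left, abs_neg, abs_div, abs_norm]
        have := hlow z hz
        gcongr
      have h9 : |‖m‖ - ‖u z‖| ≤ ‖u z - m‖ := by
        rw [← norm_neg (u z - m), neg_sub]; exact abs_norm_sub_norm_le _ _
      have h10 := abs_sub_le ‖m‖ ‖u z‖ 1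
      linarith
    have h11 : ‖u z - e‖ ≤ 2 * ‖u z - m‖ + |v z| / δ := by
      have := norm_sub_le_norm_sub_add_norm_sub (u z) m e
      linarith
    calc _ = ‖gabor f z‖ * ‖u z - e‖ := h1
      _ ≤ Δ * (2 * ‖u z - m‖ + |v z| / δ) := by
          gcongr
          exact hf'.norm_le z (hAball hz)
      _ = _ := by ring
  have hderiv : ∀ᵐ z ∂μ, ‖deriv u z‖ ≤ Δ / δ ^ 2 * (|v z| + ‖gradient v z‖) := by
    rw [hμ, ae_restrict_iff' hAo.measurableSet]
    filter_upwards [hvL.ae_differentiableAt] with z hz hzA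
    rw [norm_gradient]
    have hp : DifferentiableAt ℝ (fun w => ‖gabor f w‖) z :=
      (hcf.differentiable one_ne_zero z).norm ℝ (norm_ne_zero_iff.1 (hnu z hzA).1)
    refine norm_deriv_le_of_norm_eq hδ hδΔ (hud.differentiableAt (hAo.mem_nhds hzA)) hp hz
      (Filter.eventually_of_mem (hAo.mem_nhds hzA) hnu) (hlow z hzA) ?_
    rw [← norm_gradient]
    exact hf'.norm_gradient_le z (hAball hzA) hp
  have hvm : Measurable v := hvL.continuous.measurable
  have hgm := measurable_gradient v
  have hP : eLpNorm (fun z => u z - m) 2 μ ≤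
      ENNReal.ofReal (2 * π * s) * eLpNorm (deriv u) 2 μ :=
    eLpNorm_two_le_of_lintegral_le (by positivity) hm
  have hD : eLpNorm (deriv u) 2 μ ≤
      ENNReal.ofReal (Δ / δ ^ 2) * (eLpNorm v 2 μ + eLpNorm (gradient v) 2 μ) := by
    calc eLpNorm (deriv u) 2 μ
        ≤ ENNReal.ofReal (Δ / δ ^ 2) * eLpNorm (fun z => |v z| + ‖gradient v z‖) 2 μ := by
          refine eLpNorm_le_mul_eLpNorm_of_ae_le_mul (hderiv.mono fun z hz => ?_) 2
          rwa [Real.norm_of_nonneg (by positivity)]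
      _ ≤ ENNReal.ofReal (Δ / δ ^ 2) * (eLpNorm (fun z => ‖v z‖) 2 μ +
            eLpNorm (fun z => ‖gradient v z‖) 2 μ) := by
          gcongr
          exact eLpNorm_add_le hvm.norm.aestronglyMeasurable hgm.norm.aestronglyMeasurable
            one_le_two
      _ = _ := by rw [eLpNorm_norm, eLpNorm_norm]
  set N := eLpNorm v 2 μ + eLpNorm (gradient v) 2 μ with hN
  calc eLpNorm (fun w => gabor f w - Complex.exp (Complex.I * m.arg) * gabor g w) 2 μ
      ≤ eLpNorm ((fun z => 2 * Δ * ‖u z - m‖) + fun z => Δ / δ * ‖v z‖) 2 μ :=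
        eLpNorm_mono_ae_real ((ae_restrict_mem hAo.measurableSet).mono hpoint)
    _ ≤ eLpNorm (fun z => 2 * Δ * ‖u z - m‖) 2 μ + eLpNorm (fun z => Δ / δ * ‖v z‖) 2 μ :=
        eLpNorm_add_le (by fun_prop) (by fun_prop) one_le_two
    _ ≤ ENNReal.ofReal (2 * Δ) * eLpNorm (fun z => u z - m) 2 μ +
          ENNReal.ofReal (Δ / δ) * eLpNorm v 2 μ := by
        gcongr
        · refine eLpNorm_le_mul_eLpNorm_of_ae_le_mul (Filter.Eventually.of_forall fun z => ?_) 2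
          rw [Real.norm_of_nonneg (by positivity)]
        · refine eLpNorm_le_mul_eLpNorm_of_ae_le_mul (Filter.Eventually.of_forall fun z => ?_) 2
          rw [Real.norm_of_nonneg (by positivity)]
    _ ≤ ENNReal.ofReal (2 * Δ) * (ENNReal.ofReal (2 * π * s) *
          (ENNReal.ofReal (Δ / δ ^ 2) * N)) + ENNReal.ofReal (Δ / δ) * N := by
        gcongr
        · exact hP.trans (by gcongr)
        · exact le_self_add
    _ = ENNReal.ofReal (2 * Δ * (2 * π * s) * (Δ / δ ^ 2) + Δ / δ) * N := by
        rw [ENNReal.ofReal_add (by positivity) (by positivity),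
          ENNReal.ofReal_mul (p := 2 * Δ * (2 * π * s)) (by positivity),
          ENNReal.ofReal_mul (p := 2 * Δ) (by positivity)]
        ring
    _ ≤ ENNReal.ofReal (Δ ^ 2 / δ ^ 2 * (1 + 4 * π * s)) * N := by
        gcongr
        have h1 : 1 ≤ Δ / δ := (one_le_div hδ).2 hδΔ
        have h2 : Δ / δ ≤ Δ ^ 2 / δ ^ 2 := by
          rw [← div_pow]; nlinarith
        have h3 : 2 * Δ * (2 * π * s) * (Δ / δ ^ 2) = Δ ^ 2 / δ ^ 2 * (4 * π * s) := by ring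
        rw [h3, mul_add, mul_one]
        linarith

open Real in
-- A square-root form of `one_sub_exp_neg_pi_sq_le`. The constant `4π` instead of `2π` lets the same
-- `ρ` serve here and in the factor `1 + 4πs` from the annulus.
theorem lagoon_constant_bound {r s : ℝ} (hr : 0 ≤ r) (hrs : r < s) :
    1 - rexp (-(π * r ^ 2)) ≤
      (r ^ (1 / 2 : ℝ) * (4 * π / (1 - r / s)) * (s ^ (1 / 2 : ℝ) + s ^ (-(1 / 2) : ℝ)) *
        rexp (π * r ^ 2 / 2)) ^ 2 * (rexp (-(π * r ^ 2)) - rexp (-(π * s ^ 2))) := by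
  have hpi := Real.pi_pos
  have hs : 0 < s := hr.trans_lt hrs
  have h1τ : 0 < 1 - r / s := by rw [sub_pos, div_lt_one hs]; exact hrs
  refine (one_sub_exp_neg_pi_sq_le hr hrs).trans ?_
  have h0 : 0 ≤ rexp (-(π * r ^ 2)) - rexp (-(π * s ^ 2)) := by
    rw [sub_nonneg, Real.exp_le_exp]
    gcongr
  refine mul_le_mul_of_nonneg_right ?_ h0
  rw [mul_pow, mul_pow, mul_pow, ← Real.exp_nat_mul]
  have e1 : (r ^ (1 / 2 : ℝ)) ^ 2 = r := by
    rw [← Real.sqrt_eq_rpow, Real.sq_sqrt hr]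
  have e2 : (s ^ (1 / 2 : ℝ)) ^ 2 = s := by
    rw [← Real.sqrt_eq_rpow, Real.sq_sqrt hs.le]
  have e3 : (s ^ (-(1 / 2) : ℝ)) ^ 2 = s⁻¹ := by
    rw [Real.rpow_neg hs.le, inv_pow, e2]
  have e4 : ((2 : ℕ) : ℝ) * (π * r ^ 2 / 2) = π * r ^ 2 := by push_cast; ring
  have h2 : s + s⁻¹ ≤ (s ^ (1 / 2 : ℝ) + s ^ (-(1 / 2) : ℝ)) ^ 2 := by
    have : 0 ≤ s ^ (1 / 2 : ℝ) * s ^ (-(1 / 2) : ℝ) := by positivity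
    nlinarith
  rw [e1, e4]
  gcongr
  linarith

open Real in
-- The norm is taken on an arbitrary open `U` containing the atoll, so that the union of all atolls
-- can be used for every disc.
theorem exists_phase_eLpNorm_ball_le {f g : ℝ → ℂ} (hf : MemLp f 2 volume)
    (hg : MemLp g 2 volume) {z₀ : ℂ} {r s δ Δ : ℝ} (hr : 0 ≤ r) (hrs : r < s) (hδ : 0 < δ)
    (hδΔ : δ ≤ Δ) (hf' : IsAtollFunction (gabor f) (Metric.ball z₀ s) (Metric.ball z₀ r) δ Δ)
    {U : Set ℂ} (hU : IsOpen U) (hUsub : atoll (Metric.ball z₀ s) (Metric.ball z₀ r) ⊆ U) :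
    ∃ α : ℝ, eLpNorm (fun w => gabor f w - Complex.exp (Complex.I * α) * gabor g w) 2
        (volume.restrict (Metric.ball z₀ s)) ≤
      ENNReal.ofReal (Δ ^ 2 / δ ^ 2 * (1 + 4 * π / (1 - r / s) * s) *
        (1 + r ^ (1 / 2 : ℝ) * (4 * π / (1 - r / s)) * (s ^ (1 / 2 : ℝ) + s ^ (-(1 / 2) : ℝ)) *
          rexp (π * r ^ 2 / 2))) *
        sobolevNorm (fun w => ‖gabor f w‖ - ‖gabor g w‖) 2 U := by
  have hpi := Real.pi_pos
  have hs : 0 < s := hr.trans_lt hrs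
  have hτ : 0 ≤ r / s := by positivity
  have h1τ : 0 < 1 - r / s := by rw [sub_pos, div_lt_one hs]; exact hrs
  obtain ⟨α, hα⟩ := exists_phase_eLpNorm_annulus_le hf hg hr hrs hδ hδΔ hf'
  refine ⟨α, ?_⟩
  set κ := r ^ (1 / 2 : ℝ) * (4 * π / (1 - r / s)) * (s ^ (1 / 2 : ℝ) + s ^ (-(1 / 2) : ℝ)) *
    rexp (π * r ^ 2 / 2) with hκ
  have hκ0 : 0 ≤ κ := by positivity
  have hAU : {z : ℂ | ‖z - z₀‖ ∈ Ioo r s} ⊆ U := fun z hz =>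
    hUsub ⟨mem_ball_iff_norm.2 hz.2, fun h => not_lt.2 (mem_closedBall_iff_norm.1
      (Metric.closure_ball_subset_closedBall h)) hz.1⟩
  have hvL := lipschitzOnBalls_norm_sub_norm (contDiff_gabor hf) (contDiff_gabor hg)
  have hN := hvL.le_sobolevNorm hU
  refine (eLpNorm_ball_le_eLpNorm_annulus hf hg α z₀ hr hrs.le hκ0
    (lagoon_constant_bound hr hrs)).trans ?_
  calc _ ≤ ENNReal.ofReal (1 + κ) * (ENNReal.ofReal (Δ ^ 2 / δ ^ 2 * (1 + 4 * π * s)) *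
        sobolevNorm (fun w => ‖gabor f w‖ - ‖gabor g w‖) 2 U) := by
        refine mul_le_mul_right (hα.trans (mul_le_mul_right (le_trans ?_ hN) _)) _
        gcongr
    _ ≤ ENNReal.ofReal (1 + κ) * (ENNReal.ofReal (Δ ^ 2 / δ ^ 2 * (1 + 4 * π / (1 - r / s) * s)) *
        sobolevNorm (fun w => ‖gabor f w‖ - ‖gabor g w‖) 2 U) := by
        gcongr
        rw [le_div_iff₀ h1τ]
        nlinarith
    _ = _ := by
        rw [← mul_assoc, ← ENNReal.ofReal_mul (by positivity), mul_comm (1 + κ)]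

end GaborPhase

/-! ### Summation over the discs -/

theorem mainTheorem3 :
    ∃ (ρ : ℝ → ℝ) (c : ℝ),
      ContinuousOn ρ (Set.Ico 0 1) ∧ (∀ τ ∈ Set.Ico (0 : ℝ) 1, 0 < ρ τ) ∧ 0 < c ∧
      ∀ (k : ℕ) (z : Fin k → ℂ) (r s δ Δ : Fin k → ℝ) (f : ℝ → ℂ),
        (∀ j, 0 ≤ r j ∧ r j < s j) →
        (∀ j, 0 < δ j ∧ δ j ≤ Δ j) →
        MemLp f 2 volume →
        (∀ j, GaborPhase.IsAtollFunction (GaborPhase.gabor f)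
          (Metric.ball (z j) (s j)) (Metric.ball (z j) (r j)) (δ j) (Δ j)) →
        ∀ g : ℝ → ℂ, MemLp g 2 volume →
          GaborPhase.MemSobolev
            (fun w => ‖GaborPhase.gabor f w‖ - ‖GaborPhase.gabor g w‖) 2
            (⋃ j, GaborPhase.atoll (Metric.ball (z j) (s j)) (Metric.ball (z j) (r j))) ∧
          (⨅ α : Fin k → ℝ, ∑ j, eLpNorm
              (fun w => GaborPhase.gabor f w -
                Complex.exp (Complex.I * (α j : ℂ)) * GaborPhase.gabor g w)
              2 (volume.restrict (Metric.ball (z j) (s j)))) ≤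
            ENNReal.ofReal (c * ∑ j, (Δ j ^ 2 / δ j ^ 2) * (1 + ρ (r j / s j) * s j) *
              (1 + r j ^ (1 / 2 : ℝ) * ρ (r j / s j) *
                (s j ^ (1 / 2 : ℝ) + s j ^ (-(1 / 2) : ℝ)) *
                Real.exp (Real.pi * r j ^ 2 / 2))) *
            GaborPhase.sobolevNorm
              (fun w => ‖GaborPhase.gabor f w‖ - ‖GaborPhase.gabor g w‖) 2
              (⋃ j, GaborPhase.atoll (Metric.ball (z j) (s j)) (Metric.ball (z j) (r j))) := by
  have hpi := Real.pi_pos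
  refine ⟨fun τ => 4 * Real.pi / (1 - τ), 1, ?_, ?_, one_pos, ?_⟩
  · exact continuousOn_const.div (by fun_prop) fun τ hτ => (sub_pos.2 hτ.2).ne'
  · exact fun τ hτ => div_pos (by positivity) (sub_pos.2 hτ.2)
  intro k z r s δ Δ f hrs hδ hf hatoll g hg
  have hUo : IsOpen (⋃ j, GaborPhase.atoll (Metric.ball (z j) (s j)) (Metric.ball (z j) (r j))) :=
    isOpen_iUnion fun j => Metric.isOpen_ball.sdiff isClosed_closure
  have hUb : Bornology.IsBounded
      (⋃ j, GaborPhase.atoll (Metric.ball (z j) (s j)) (Metric.ball (z j) (r j))) :=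
    Bornology.isBounded_iUnion.2 fun j => Metric.isBounded_ball.subset sdiff_subset
  have hvL := GaborPhase.lipschitzOnBalls_norm_sub_norm (GaborPhase.contDiff_gabor hf)
    (GaborPhase.contDiff_gabor hg)
  refine ⟨hvL.memSobolev hUo hUb, ?_⟩
  choose α hα using fun j => GaborPhase.exists_phase_eLpNorm_ball_le hf hg (hrs j).1 (hrs j).2
    (hδ j).1 (hδ j).2 (hatoll j) hUo
    (subset_iUnion (fun j => GaborPhase.atoll (Metric.ball (z j) (s j)) (Metric.ball (z j) (r j))) j)
  -- The phases are chosen disc by disc; all summands share the same Sobolev norm, so only the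
  -- constants add up.
  refine (iInf_le _ α).trans ((Finset.sum_le_sum fun j _ => hα j).trans_eq ?_)
  rw [← Finset.sum_mul, one_mul, ENNReal.ofReal_sum_of_nonneg]
  intro j _
  have hs : 0 < s j := (hrs j).1.trans_lt (hrs j).2
  have hr : 0 ≤ r j := (hrs j).1
  have h1τ : 0 < 1 - r j / s j := by rw [sub_pos, div_lt_one hs]; exact (hrs j).2
  positivity
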